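/- **Setting.** Let $\mathcal H$ and $\mathcal G_1,\dots,\mathcal G_s$ be real Hilbert spaces, let $\rho$ be a probability measure on a measurable space $\Xi$ (for instance the uniform measure on a finite sample), let $\beta>0$, and let $\ell\colon\Xi\times\mathcal H\to[0,+\infty[$ be such that $\ell(\cdot,w)$ is $\rho$-integrable for every $w\in\mathcal H$, $\ell(\xi,\cdot)$ is differentiable for every $\xi\in\Xi$, and $$\|\nabla_w\ell(\xi,w_1)-\nabla_w\ell(\xi,w_2)\|\le \tfrac1\beta\|w_1-w_2\|\qquad(\xi\in\Xi,\ w_1,w_2\in\mathcal H).$$ Assume that $F=\int_\Xi \ell(\xi,\cdot)\,d\rho(\xi)$ is convex. Let $f\colon\mathcal H\to\mathbb R$ be convex and lower semicontinuous, let $g_k\colon\mathcal G_k\to[0,+\infty]$ be proper, convex and lower semicontinuous with conjugate $g_k^*$, and let $D_k\colon\mathcal H\to\mathcal G_k$ be bounded and linear ($1\le k\le s$). A primal-dual solution is a vector $(\overline w,\overline v_1,\dots,\overline v_s)\in\mathcal H\times\mathcal G_1\times\dots\times\mathcal G_s$ with $$0\in\nabla F(\overline w)+\partial f(\overline w)+\sum_{k=1}^sD_k^*\overline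 v_k,\qquad 0\in -D_k\overline w+\partial g_k^*(\overline v_k)\quad(1\le k\le s).$$ Assume that a primal-dual solution exists. **Algorithm.** Let $V$ on $\mathcal H$ and $W_k$ on $\mathcal G_k$ be bounded linear operators that are self-adjoint and strongly positive. For a self-adjoint strongly positive $M$ write $\operatorname{prox}_h^{M}(x)=\operatorname{argmin}_y\, h(y)+\frac12\langle M(y-x),y-x\rangle$. Let $\varepsilon\in\,]0,1[$ and $(\alpha_n)_{n\in\mathbb N}$ in $[0,1-\varepsilon]$. On a probability space, let $(\mathrm a_n)_{n\in\mathbb N}$ be square integrable $\mathcal H$-valued random vectors, let $w_0$ and $v_{k,0}$ be square integrable random vectors with values in $\mathcal H$ and $\mathcal G_k$, put $w_{-1}=w_0$, $v_{k,-1}=v_{k,0}$, and for every $n\in\mathbb N$ let $$\begin{aligned} u_n&=w_n+\alpha_n(w_n-w_{n-1}),\qquad d_{k,n}=v_{k,n}+\alpha_n(v_{k,n}-v_{k,n-1})\quad(1\le k\le s),\\ w_{n+1}&=\operatorname{prox}_f^{V^{-1}}\Big(u_n-V\Big(\sum_{k=1}^sD_k^*d_{k,n}+\mathrm a_n\Big)\Big),\\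 v_{k,n+1}&=\operatorname{prox}_{g_k^*}^{W_k^{-1}}\big(d_{k,n}+W_kD_k(2w_{n+1}-u_n)\big)\quad(1\le k\le s). \end{aligned}$$ Let $\mathcal F_n=\sigma\big((w_0,v_0),\dots,(w_n,v_n)\big)$, where $v_n=(v_{1,n},\dots,v_{s,n})$. **Theorem.** Assume that $$\gamma=\Big(1-\Big(\sum_{k=1}^s\|W_k^{1/2}D_kV^{1/2}\|^2\Big)^{1/2}\Big)\|V\|^{-1}\beta>\tfrac12,\qquad \varepsilon<\min\{1,\gamma\},$$ and that 1. $\mathsf E[\mathrm a_n\mid\mathcal F_n]=\nabla F(u_n)$ almost surely, for every $n\in\mathbb N$; 2. $\sum_{n\in\mathbb N}\mathsf E[\|\mathrm a_n-\nabla F(u_n)\|^2\mid\mathcal F_n]<+\infty$ almost surely; 3. $\sup_n\|w_n-w_{n-1}\|<\infty$ almost surely, $\max_{1\le k\le s}\sup_n\|v_{k,n}-v_{k,n-1}\|<\infty$ almost surely, and $\sum_{n\in\mathbb N}\alpha_n<+\infty$. Then there is a random vector $(\overline w,\overline v_1,\dots,\overline v_s)$ that is almost surely a primal-dual solution, such that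 (i) almost surely, $w_n\rightharpoonup\overline w$ and $v_{k,n}\rightharpoonup\overline v_k$ weakly for every $k\in\{1,\dots,s\}$; (ii) if $F$ is almost surely uniformly convex at $\overline w$, then $w_n\to\overline w$ strongly almost surely. Here $F$ is uniformly convex at $x$ if there is a nondecreasing $\varphi\colon[0,+\infty[\to[0,+\infty[$ vanishing only at $0$ with $F(tx+(1-t)y)+t(1-t)\varphi(\|x-y\|)\le tF(x)+(1-t)F(y)$ for all $y\in\mathcal H$ and $t\in\,]0,1[$. -/

import Mathlib

open MeasureTheory Filter Topology

namespace InertialPD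

section Operators

variable {E : Type*} [NormedAddCommGroup E] [InnerProductSpace ℝ E] [CompleteSpace E]

/-- A bounded operator on a real Hilbert space is self-adjoint and strongly positive if it is
self-adjoint and `⟪T x, x⟫ ≥ c ‖x‖²` for some `c > 0`. -/
def StronglyPositive (T : E →L[ℝ] E) : Prop :=
  IsSelfAdjoint T ∧ ∃ c : ℝ, 0 < c ∧ ∀ x : E, c * ‖x‖ ^ 2 ≤ inner ℝ (T x) x

/-- The positive square root of a positive bounded operator: the positive self-adjoint `S` with
`S ∘ S = T`, which exists and is unique when `T` is positive and self-adjoint. -/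
noncomputable def opSqrt (T : E →L[ℝ] E) : E →L[ℝ] E :=
  Classical.epsilon fun S : E →L[ℝ] E => S.IsPositive ∧ S ∘L S = T

end Operators

section ConvexAnalysis

variable {E : Type*} [NormedAddCommGroup E] [InnerProductSpace ℝ E]

/-- The (Fenchel) conjugate `h*(v) = sup_x (⟪x, v⟫ - h x)` of a `[0, +∞]`-valued function. -/
noncomputable def conjugate (h : E → ENNReal) (v : E) : EReal :=
  ⨆ x : E, ((inner ℝ x v : ℝ) : EReal) - (h x : EReal)

/-- The subdifferential of a proper function with values in `(-∞, +∞]`. -/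
def subdifferential (h : E → EReal) (x : E) : Set E :=
  {p | ∀ y : E, h x + ((inner ℝ (y - x) p : ℝ) : EReal) ≤ h y}

/-- `p = prox_h^M (x)`: `p` is the (unique, for `h` proper, convex, lower semicontinuous and `M`
self-adjoint and strongly positive) minimizer of `y ↦ h y + ½ ⟪M (y - x), y - x⟫`, the second
term being half the squared distance from `x` in the norm induced by `M`. -/
def IsProx (M : E →L[ℝ] E) (h : E → EReal) (x p : E) : Prop :=
  IsMinOn (fun y : E => h y + (((1 / 2 : ℝ) * inner ℝ (M (y - x)) (y - x) : ℝ) : EReal))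
    Set.univ p

/-- The real-valued function `F` is uniformly convex at `x`: there is a modulus `φ`, nondecreasing on
`[0, +∞)` and vanishing only at `0`, with
`F (t x + (1 - t) y) + t (1 - t) φ(‖x - y‖) ≤ t F x + (1 - t) F y` for all `y` and `0 < t < 1`. -/
def UniformlyConvexAt (F : E → ℝ) (x : E) : Prop :=
  ∃ φ : ℝ → ℝ, MonotoneOn φ (Set.Ici 0) ∧ φ 0 = 0 ∧ (∀ r : ℝ, 0 < r → 0 < φ r) ∧
    ∀ y : E, ∀ t ∈ Set.Ioo (0 : ℝ) 1,
      F (t • x + (1 - t) • y) + t * (1 - t) * φ ‖x - y‖ ≤ t * F x + (1 - t) * F y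

end ConvexAnalysis

/-- The expected loss `F w = 𝔼[ℓ(ξ, w)]`, with `ξ` of law `ρ`. -/
noncomputable def expectedLoss {Ξ H : Type*} [MeasurableSpace Ξ] (ρ : Measure Ξ)
    (ℓ : Ξ → H → ℝ) (w : H) : ℝ :=
  ∫ ξ, ℓ ξ w ∂ρ

/-- The inertial extrapolation `x_n + α_n (x_n - x_{n-1})`. Truncated subtraction gives
`x (0 - 1) = x 0`, which is the convention `x_{-1} = x_0`. -/
def extrapolate {E : Type*} [AddCommGroup E] [Module ℝ E] (α : ℕ → ℝ) (x : ℕ → E) (n : ℕ) : E :=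
  x n + α n • (x n - x (n - 1))

section PrimalDual

variable {H : Type*} [NormedAddCommGroup H] [InnerProductSpace ℝ H] [CompleteSpace H]
  {s : ℕ} {G : Fin s → Type*} [∀ k, NormedAddCommGroup (G k)]
  [∀ k, InnerProductSpace ℝ (G k)] [∀ k, CompleteSpace (G k)]

/-- `(w, v)` is a primal-dual solution:
`0 ∈ ∇F(w) + ∂f(w) + ∑ₖ Dₖ* vₖ` and `0 ∈ -Dₖ w + ∂gₖ*(vₖ)` for every `k`. -/
def IsPrimalDualSolution (F f : H → ℝ) (g : (k : Fin s) → G k → ENNReal)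
    (D : (k : Fin s) → H →L[ℝ] G k) (w : H) (v : (k : Fin s) → G k) : Prop :=
  (∃ p ∈ subdifferential (fun x => (f x : EReal)) w,
    0 = gradient F w + p + ∑ k, (D k).adjoint (v k)) ∧
  ∀ k, ∃ q ∈ subdifferential (conjugate (g k)) (v k), 0 = -(D k w) + q

/-- The sequences `w`, `v` are generated from the gradient estimates `a` by the inertial
primal-dual iteration with preconditioners `V`, `W k` and inertial parameters `α`:
with `uₙ = wₙ + αₙ (wₙ - wₙ₋₁)` and `dₖₙ = vₖₙ + αₙ (vₖₙ - vₖₙ₋₁)`,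
`wₙ₊₁ = prox_f^{V⁻¹} (uₙ - V (∑ₖ Dₖ* dₖₙ + aₙ))` and
`vₖₙ₊₁ = prox_{gₖ*}^{Wₖ⁻¹} (dₖₙ + Wₖ Dₖ (2 wₙ₊₁ - uₙ))`. -/
structure IsPrimalDualIteration (f : H → ℝ) (g : (k : Fin s) → G k → ENNReal)
    (D : (k : Fin s) → H →L[ℝ] G k) (V : H →L[ℝ] H) (W : (k : Fin s) → G k →L[ℝ] G k)
    (α : ℕ → ℝ) (a w : ℕ → H) (v : (k : Fin s) → ℕ → G k) : Prop where
  primal : ∀ n, IsProx V.inverse (fun x => (f x : EReal))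
    (extrapolate α w n - V (∑ k, (D k).adjoint (extrapolate α (v k) n) + a n)) (w (n + 1))
  dual : ∀ k n, IsProx (W k).inverse (conjugate (g k))
    (extrapolate α (v k) n + W k (D k ((2 : ℝ) • w (n + 1) - extrapolate α w n))) (v k (n + 1))

/-- The σ-algebra generated by `(w₀, v₀), …, (wₙ, vₙ)`. -/
abbrev history {Ω : Type*} (w : ℕ → Ω → H) (v : (k : Fin s) → ℕ → Ω → G k) (n : ℕ) :
    MeasurableSpace Ω :=
  ⨆ i ∈ Set.Iic n, (MeasurableSpace.comap (w i) (borel H) ⊔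
    ⨆ k, MeasurableSpace.comap (v k i) (borel (G k)))

end PrimalDual

end InertialPD

open InertialPD

/-! In the Hilbert sum of the primal and dual spaces the solutions are the zeros of A + π†∇Fπ, where
π is the primal projection and A (`saddleRelation`) is monotone, being a subdifferential plus a skew
coupling. With S the operator `preconditioner`, one iteration is exactly z ↦ (S + A)⁻¹(S z − π†a) at
the extrapolated point z (`saddleRelation_of_iteration`). The algorithm is thus a stochastic
forward-backward iteration in the metric of S. The condition γ > 1/2 makes S strongly positive, and
γ = κβ, where κ‖πx‖² ≤ ⟪Sx, x⟫ and β is the cocoercivity constant of ∇F (Baillon–Haddad).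

For a fixed zero x', `exists_step_inequality` bounds the squared S-distance to x' after one step.
The noise enters linearly only through the exact step, which is known at time n, so unbiasedness
removes it in conditional mean; what remains is quadratic in the noise, hence summable. Inertia
costs a factor 1 + αₙ and a term that is summable because the increments are bounded.
Robbins–Siegmund then gives, almost surely, convergence of the S-distance, and decay to zero of both
the exact forward-backward residual and ∇F(uₙ) − ∇F(πx').

Weak cluster points are zeros because A is closed for weak convergence of points and strong
convergence of images. Opial's argument, run over a countable dense set of zeros so that one null
set suffices, leaves a single cluster point. Strong convergence holds because ∇F(uₙ) converges
strongly to ∇F(w̄), and its pairing with the bounded sequence uₙ − w̄ dominates the modulus of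
uniform convexity. -/

namespace InertialPD

/-! ### Weak convergence along filters, in terms of inner products. -/

section WeakConvergence

variable {E : Type*} [NormedAddCommGroup E] [InnerProductSpace ℝ E]

/-- Weak convergence of a sequence along a filter, tested against inner products. -/
def WeakTendsto (x : ℕ → E) (l : Filter ℕ) (x₀ : E) : Prop :=
  ∀ y : E, Tendsto (fun n => inner ℝ y (x n)) l (𝓝 (inner ℝ y x₀))

/-- Riesz representation: testing against functionals is testing against vectors. The weak topology
itself is needed only for Mazur's theorem and for the final statement. -/
theorem weakTendsto_iff_toWeakSpace [CompleteSpace E] {x : ℕ → E} {l : Filter ℕ} {x₀ : E} :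
    WeakTendsto x l x₀ ↔
      Tendsto (fun n => toWeakSpace ℝ E (x n)) l (𝓝 (toWeakSpace ℝ E x₀)) := by
  have hinj : Function.Injective (topDualPairing ℝ E).flip := by
    intro a b hab
    refine ext_inner_left ℝ fun y => ?_
    exact congrArg (fun T : StrongDual ℝ E →ₗ[ℝ] ℝ => T (innerSL ℝ y)) hab
  constructor
  · intro h
    refine (WeakBilin.tendsto_iff_forall_eval_tendsto (B := (topDualPairing ℝ E).flip) hinj).2
      fun φ => ?_
    have := h ((InnerProductSpace.toDual ℝ E).symm φ)
    simp only [InnerProductSpace.toDual_symm_apply] at this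
    exact this
  · intro h y
    exact (WeakBilin.tendsto_iff_forall_eval_tendsto (B := (topDualPairing ℝ E).flip) hinj).1 h
      (innerSL ℝ y)

theorem WeakTendsto.of_tendsto {x : ℕ → E} {l : Filter ℕ} {x₀ : E} (h : Tendsto x l (𝓝 x₀)) :
    WeakTendsto x l x₀ := fun _ => tendsto_const_nhds.inner h

theorem WeakTendsto.add_of_tendsto_zero {x e : ℕ → E} {l : Filter ℕ} {x₀ : E}
    (h : WeakTendsto x l x₀) (he : Tendsto e l (𝓝 0)) :
    WeakTendsto (fun n => x n + e n) l x₀ := by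
  intro y
  have := (h y).add ((tendsto_const_nhds (x := y)).inner he)
  simpa [inner_add_right] using this

theorem WeakTendsto.map [CompleteSpace E] {F : Type*} [NormedAddCommGroup F]
    [InnerProductSpace ℝ F] [CompleteSpace F] {x : ℕ → E} {l : Filter ℕ} {x₀ : E}
    (h : WeakTendsto x l x₀) (T : E →L[ℝ] F) : WeakTendsto (fun n => T (x n)) l (T x₀) := by
  intro y
  simpa [ContinuousLinearMap.adjoint_inner_left] using h (T.adjoint y)

/-- A strongly convergent and a bounded weakly convergent sequence have convergent inner
products. -/
theorem WeakTendsto.inner_of_tendsto {x p : ℕ → E} {l : Filter ℕ} {x₀ p₀ : E}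
    (h : WeakTendsto x l x₀) (hp : Tendsto p l (𝓝 p₀)) {C : ℝ} (hC : ∀ n, ‖x n‖ ≤ C) :
    Tendsto (fun n => inner ℝ (p n) (x n)) l (𝓝 (inner ℝ p₀ x₀)) := by
  have h1 : Tendsto (fun n => inner ℝ (p n - p₀) (x n)) l (𝓝 0) := by
    have h2 : Tendsto (fun n => ‖p n - p₀‖ * C) l (𝓝 0) := by
      simpa using (tendsto_iff_norm_sub_tendsto_zero.1 hp).mul_const C
    refine squeeze_zero_norm (fun n => ?_) h2
    exact (norm_inner_le_norm _ _).trans (mul_le_mul_of_nonneg_left (hC n) (norm_nonneg _))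
  have := h1.add (h p₀)
  simpa [inner_sub_left] using this

end WeakConvergence

/-! ### Closed convex functions, subdifferentials and proximal points. -/

section ConvexFunctions

variable {E : Type*} [NormedAddCommGroup E] [InnerProductSpace ℝ E]

/-- A proper, convex, weakly lower semicontinuous function with an at most linear lower bound. -/
structure IsClosedConvex (h : E → EReal) : Prop where
  ne_bot : ∀ x, h x ≠ ⊥
  exists_ne_top : ∃ x, h x ≠ ⊤
  convex : ∀ x y : E, ∀ a b t : ℝ, h x ≤ a → h y ≤ b → 0 ≤ t → t ≤ 1 →
    h ((1 - t) • x + t • y) ≤ (((1 - t) * a + t * b : ℝ) : EReal)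
  -- Real majorants `a n` stand in for the values of `h`, so that limits are taken in ℝ; the filter
  -- is general because cluster points are obtained along ultrafilters.
  le_of_weakTendsto : ∀ (l : Filter ℕ) [l.NeBot] (x : ℕ → E) (x₀ : E) (a : ℕ → ℝ) (a₀ : ℝ),
    WeakTendsto x l x₀ → Tendsto a l (𝓝 a₀) → (∀ n, h (x n) ≤ a n) → h x₀ ≤ a₀
  minorant : ∃ r b : ℝ, 0 ≤ r ∧ ∀ y, ((-(r * ‖y‖) - b : ℝ) : EReal) ≤ h y

theorem conjugate_le_iff {g : E → ENNReal} {v : E} {a : ℝ} :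
    conjugate g v ≤ a ↔ ∀ x, g x ≠ ⊤ → inner ℝ x v - (g x).toReal ≤ a := by
  have key : ∀ x, g x ≠ ⊤ → ((inner ℝ x v : ℝ) : EReal) - (g x : EReal) =
      ((inner ℝ x v - (g x).toReal : ℝ) : EReal) := by
    intro x hx
    lift g x to NNReal using hx with r
    rfl
  rw [conjugate, iSup_le_iff]
  refine forall_congr' fun x => ?_
  by_cases hx : g x = ⊤
  · simp [hx]
  · simp only [ne_eq, hx, not_false_eq_true, forall_const, key x hx, EReal.coe_le_coe_iff]

/-- A conjugate is a supremum of weakly continuous affine functions and inherits convexity and weak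
lower semicontinuity from them; any point where `g` is finite supplies an affine minorant. -/
theorem isClosedConvex_conjugate {g : E → ENNReal} (hg : ∃ x, g x ≠ ⊤) :
    IsClosedConvex (conjugate g) := by
  obtain ⟨x₀, hx₀⟩ := hg
  have hlow : ∀ v, ((inner ℝ x₀ v - (g x₀).toReal : ℝ) : EReal) ≤ conjugate g v := by
    intro v
    refine EReal.le_of_forall_lt_iff_le.1 fun a ha => ?_
    exact EReal.coe_le_coe_iff.2 (conjugate_le_iff.1 ha.le x₀ hx₀)
  refine ⟨fun v hv => ?_, ⟨0, ?_⟩, ?_, ?_, ⟨‖x₀‖, (g x₀).toReal, norm_nonneg _, fun y => ?_⟩⟩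
  · have := hlow v
    rw [hv, le_bot_iff] at this
    exact EReal.coe_ne_bot _ this
  -- Nonnegativity of `g` makes the conjugate finite at the origin.
  · have : conjugate g 0 ≤ ((0 : ℝ) : EReal) := conjugate_le_iff.2 fun x _ => by simp
    exact ne_top_of_le_ne_top (EReal.coe_ne_top _) this
  · intro x y a b t hx hy ht ht'
    rw [conjugate_le_iff] at *
    intro z hz
    have h1 := hx z hz
    have h2 := hy z hz
    rw [inner_add_right, inner_smul_right, inner_smul_right]
    nlinarith [mul_le_mul_of_nonneg_left h1 (sub_nonneg.2 ht'), mul_le_mul_of_nonneg_left h2 ht]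
  · intro l _ x x₁ a a₁ hx ha h
    rw [conjugate_le_iff]
    intro z hz
    exact le_of_tendsto_of_tendsto' ((hx z).sub_const _) ha fun n => conjugate_le_iff.1 (h n) z hz
  · refine le_trans (EReal.coe_le_coe_iff.2 ?_) (hlow y)
    have := abs_le.1 (abs_real_inner_le_norm x₀ y)
    linarith [this.1]

/-- Mazur: the sublevel set at any level b > a₀ is convex and closed, hence weakly closed, and it
eventually contains the sequence. -/
theorem le_of_weakTendsto_of_convexOn [CompleteSpace E] {f : E → ℝ}
    (hf : ConvexOn ℝ Set.univ f) (hlsc : LowerSemicontinuous f)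
    {l : Filter ℕ} [l.NeBot] {x : ℕ → E} {x₀ : E} {a : ℕ → ℝ} {a₀ : ℝ}
    (hx : WeakTendsto x l x₀) (ha : Tendsto a l (𝓝 a₀)) (h : ∀ n, f (x n) ≤ a n) : f x₀ ≤ a₀ := by
  refine le_of_forall_gt_imp_ge_of_dense fun b hb => ?_
  have hconv : Convex ℝ {y | f y ≤ b} := by
    have := hf.convex_le b
    simpa using this
  have hclosed : IsClosed {y | f y ≤ b} := hlsc.isClosed_preimage b
  have hw := hconv.toWeakSpace_closure ℝ
  rw [hclosed.closure_eq] at hw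
  have hmem : toWeakSpace ℝ E x₀ ∈ toWeakSpace ℝ E '' {y | f y ≤ b} := by
    rw [hw]
    refine mem_closure_of_tendsto (weakTendsto_iff_toWeakSpace.1 hx) ?_
    filter_upwards [ha.eventually (gt_mem_nhds hb)] with n hn
    exact ⟨x n, (h n).trans hn.le, rfl⟩
  obtain ⟨y, hy, hyx⟩ := hmem
  rwa [(toWeakSpace ℝ E).injective hyx] at hy

theorem isClosedConvex_coe [CompleteSpace E] {f : E → ℝ}
    (hf : ConvexOn ℝ Set.univ f) (hlsc : LowerSemicontinuous f) :
    IsClosedConvex fun x => (f x : EReal) := by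
  refine ⟨fun x => EReal.coe_ne_bot _, ⟨0, EReal.coe_ne_top _⟩, ?_, ?_, ?_⟩
  · intro x y a b t hx hy ht ht'
    rw [EReal.coe_le_coe_iff] at *
    refine (hf.2 trivial trivial (sub_nonneg.2 ht') ht (by ring)).trans ?_
    simp only [smul_eq_mul]
    nlinarith [mul_le_mul_of_nonneg_left hx (sub_nonneg.2 ht'), mul_le_mul_of_nonneg_left hy ht]
  · intro l _ x x₀ a a₀ hx ha h
    exact EReal.coe_le_coe_iff.2 (le_of_weakTendsto_of_convexOn hf hlsc hx ha fun n =>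
      EReal.coe_le_coe_iff.1 (h n))
  · have h0 := hlsc 0 (f 0 - 1) (by linarith)
    obtain ⟨r, hr, hball⟩ := Metric.eventually_nhds_iff.1 h0
    refine ⟨2 / r, 1 - f 0, by positivity, fun y => EReal.coe_le_coe_iff.2 ?_⟩
    by_cases hy : ‖y‖ < r
    · have := @hball y (by simpa using hy)
      have : 0 ≤ 2 / r * ‖y‖ := by positivity
      linarith
    · push Not at hy
      have hy0 : 0 < ‖y‖ := hr.trans_le hy
      -- This factor scales `y` to norm r / 2, inside the ball where f exceeds f 0 − 1; convexity on
      -- the segment from 0 to `y` then bounds f y below by −1/t + f 0, where 1/t = 2‖y‖/r.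
      set t := r / (2 * ‖y‖) with ht
      have ht0 : 0 < t := by positivity
      have ht1 : t ≤ 1 := by rw [ht, div_le_one (by positivity)]; linarith
      have h1 := @hball (t • y) (by
        rw [dist_zero_right, norm_smul, Real.norm_of_nonneg ht0.le, ht]
        field_simp
        linarith)
      have h2 := hf.2 (Set.mem_univ 0) (Set.mem_univ y) (sub_nonneg.2 ht1) ht0.le (by ring)
      simp only [smul_zero, zero_add, smul_eq_mul] at h2
      have h3 : 2 / r * ‖y‖ = 1 / t := by rw [ht]; field_simp
      have h4 : t * (-(1 / t) + f 0) ≤ t * f y := by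
        have : t * (1 / t) = 1 := by field_simp
        nlinarith
      have := le_of_mul_le_mul_left h4 ht0
      rw [h3]; linarith

theorem inner_sub_nonneg_of_mem_subdifferential {h : E → EReal} (hh : IsClosedConvex h)
    {x y p q : E} (hp : p ∈ subdifferential h x) (hq : q ∈ subdifferential h y) :
    0 ≤ inner ℝ (p - q) (x - y) := by
  have fin : ∀ {x p : E}, p ∈ subdifferential h x → h x ≠ ⊤ := by
    intro x p hp hx
    obtain ⟨z, hz⟩ := hh.exists_ne_top
    have := hp z
    rw [hx, EReal.top_add_coe, top_le_iff] at this
    exact hz this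
  have h1 := hp y
  have h2 := hq x
  lift h x to ℝ using ⟨fin hp, hh.ne_bot x⟩ with a
  lift h y to ℝ using ⟨fin hq, hh.ne_bot y⟩ with b
  norm_cast at h1 h2
  have h3 : inner ℝ (x - y) q = - inner ℝ (y - x) q := by rw [← inner_neg_left, neg_sub]
  have h4 : inner ℝ (p - q) (x - y) = -inner ℝ (y - x) p + inner ℝ (y - x) q := by
    rw [real_inner_comm, ← neg_sub y x, inner_neg_left, inner_sub_right]; ring
  rw [h4]; linarith

section Prox

variable {M : E →L[ℝ] E} {h : E → EReal}

theorem inner_map_expand (hM : ∀ x y, inner ℝ (M x) y = inner ℝ x (M y)) (a d : E) (t : ℝ) :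
    inner ℝ (M (a + t • d)) (a + t • d) =
      inner ℝ (M a) a + 2 * t * inner ℝ (M a) d + t ^ 2 * inner ℝ (M d) d := by
  simp only [map_add, map_smul, inner_add_left, inner_add_right, real_inner_smul_left,
    real_inner_smul_right]
  rw [hM d a, real_inner_comm (M a) d]
  ring

/-- Fermat's rule: compare the minimizer with the points (1 − t)p + ty, cancel one factor t and let
t → 0, which removes the quadratic term. -/
theorem IsProx.mem_subdifferential (hM : ∀ x y, inner ℝ (M x) y = inner ℝ x (M y))
    (hh : IsClosedConvex h) {x p : E} (hp : IsProx M h x p) :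
    M (x - p) ∈ subdifferential h p := by
  have hmin : ∀ y, h p + (((1 / 2 : ℝ) * inner ℝ (M (p - x)) (p - x) : ℝ) : EReal) ≤
      h y + (((1 / 2 : ℝ) * inner ℝ (M (y - x)) (y - x) : ℝ) : EReal) := fun y => hp (Set.mem_univ y)
  have hfin : h p ≠ ⊤ := by
    intro htop
    obtain ⟨z, hz⟩ := hh.exists_ne_top
    have := hmin z
    lift h z to ℝ using ⟨hz, hh.ne_bot z⟩ with b
    rw [htop, EReal.top_add_coe, top_le_iff] at this
    exact EReal.add_ne_top (EReal.coe_ne_top _) (EReal.coe_ne_top _) this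
  intro y
  by_cases hy : h y = ⊤
  · rw [hy]; exact le_top
  obtain ⟨a, ha⟩ : ∃ a : ℝ, h p = a := ⟨_, (EReal.coe_toReal hfin (hh.ne_bot p)).symm⟩
  obtain ⟨b, hb⟩ : ∃ b : ℝ, h y = b := ⟨_, (EReal.coe_toReal hy (hh.ne_bot y)).symm⟩
  rw [ha, hb]
  norm_cast
  set d := y - p
  have hineq : ∀ t ∈ Set.Ioo (0 : ℝ) 1,
      a - b ≤ inner ℝ (M (p - x)) d + t * ((1 / 2) * inner ℝ (M d) d) := by
    intro t ht
    have hc := hh.convex p y a b t ha.le hb.le ht.1.le ht.2.le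
    have h1 := (hmin ((1 - t) • p + t • y)).trans (add_le_add_left hc _)
    rw [ha] at h1
    have h2 : (1 - t) • p + t • y - x = (p - x) + t • d := by
      simp only [d, sub_smul, one_smul, smul_sub]; abel
    rw [h2, inner_map_expand hM] at h1
    norm_cast at h1
    have h3 : t * (a - b) ≤ t * (inner ℝ (M (p - x)) d + t * ((1 / 2) * inner ℝ (M d) d)) := by
      nlinarith
    exact le_of_mul_le_mul_left h3 ht.1
  have hlim : Tendsto (fun t : ℝ => inner ℝ (M (p - x)) d + t * ((1 / 2) * inner ℝ (M d) d))
      (𝓝[>] 0) (𝓝 (inner ℝ (M (p - x)) d)) := by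
    have : Tendsto (fun t : ℝ => inner ℝ (M (p - x)) d + t * ((1 / 2) * inner ℝ (M d) d))
        (𝓝 0) (𝓝 (inner ℝ (M (p - x)) d + 0 * ((1 / 2) * inner ℝ (M d) d))) :=
      Continuous.tendsto (by fun_prop) 0
    rw [zero_mul, add_zero] at this
    exact this.mono_left nhdsWithin_le_nhds
  have hfinal := ge_of_tendsto hlim
    (eventually_of_mem (Ioo_mem_nhdsGT (zero_lt_one' ℝ)) hineq)
  have h5 : inner ℝ d (M (x - p)) = - inner ℝ (M (p - x)) d := by
    rw [real_inner_comm, ← neg_sub p x, map_neg, inner_neg_left]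
  rw [h5]; linarith

/-- The linear minorant keeps the infimum finite, and strong convexity of the quadratic term makes a
minimizing sequence Cauchy. Existence at every point is what allows the resolvent to be a globally
defined map. -/
theorem exists_isProx [CompleteSpace E] (hM : ∀ x y, inner ℝ (M x) y = inner ℝ x (M y))
    {c : ℝ} (hc : 0 < c) (hMc : ∀ x, c * ‖x‖ ^ 2 ≤ inner ℝ (M x) x)
    (hh : IsClosedConvex h) (x : E) : ∃ p, IsProx M h x p := by
  set q : E → ℝ := fun y => (1 / 2 : ℝ) * inner ℝ (M (y - x)) (y - x) with hq
  have hqcont : Continuous q := by fun_prop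
  -- The real numbers that majorize the objective at some point, so that the infimum is taken in ℝ.
  set T : Set ℝ := {r | ∃ y, h y ≤ ((r - q y : ℝ) : EReal)} with hT
  have hTne : T.Nonempty := by
    obtain ⟨z, hz⟩ := hh.exists_ne_top
    refine ⟨(h z).toReal + q z, z, ?_⟩
    rw [add_sub_cancel_right, EReal.coe_toReal hz (hh.ne_bot z)]
  have hTbdd : BddBelow T := by
    obtain ⟨r, b, hr, hmin⟩ := hh.minorant
    refine ⟨-(r ^ 2 / (2 * c)) - r * ‖x‖ - b, ?_⟩
    rintro s ⟨y, hy⟩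
    have h1 := EReal.coe_le_coe_iff.1 ((hmin y).trans hy)
    have h2 := hMc (y - x)
    have h3 : ‖y‖ ≤ ‖y - x‖ + ‖x‖ := by simpa using norm_add_le (y - x) x
    have h4 : r * ‖y - x‖ ≤ c / 2 * ‖y - x‖ ^ 2 + r ^ 2 / (2 * c) := by
      have : c / 2 * ‖y - x‖ ^ 2 + r ^ 2 / (2 * c) - r * ‖y - x‖ =
          (c * ‖y - x‖ - r) ^ 2 / (2 * c) := by field_simp; ring
      have : 0 ≤ (c * ‖y - x‖ - r) ^ 2 / (2 * c) := by positivity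
      linarith
    have h5 := mul_le_mul_of_nonneg_left h3 hr
    simp only [hq] at h1
    linarith
  set m := sInf T
  have hseq : ∀ n : ℕ, ∃ y, h y ≤ ((m + 1 / ((n : ℝ) + 1) - q y : ℝ) : EReal) := by
    intro n
    obtain ⟨r, ⟨y, hy⟩, hr⟩ := exists_lt_of_csInf_lt hTne
      (lt_add_of_pos_right m (Nat.one_div_pos_of_nat (α := ℝ) (n := n)))
    exact ⟨y, hy.trans (EReal.coe_le_coe_iff.2 (by linarith))⟩
  choose y hy using hseq
  have hpar : ∀ n k, c / 4 * ‖y n - y k‖ ^ 2 ≤ 1 / ((n : ℝ) + 1) + 1 / ((k : ℝ) + 1) := by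
    intro n k
    have h1 := hh.convex (y n) (y k) _ _ (1 / 2) (hy n) (hy k) (by norm_num) (by norm_num)
    set z := ((1 : ℝ) - 1 / 2) • y n + (1 / 2 : ℝ) • y k with hz
    have hqz : q z = (q (y n) + q (y k)) / 2 - 1 / 8 * inner ℝ (M (y k - y n)) (y k - y n) := by
      have e1 : z - x = (y n - x) + (1 / 2 : ℝ) • (y k - y n) := by
        rw [hz]; module
      have e2 : y k - x = (y n - x) + (1 : ℝ) • (y k - y n) := by module
      simp only [hq, e1]
      rw [e2, inner_map_expand hM, inner_map_expand hM]
      ring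
    -- The midpoint `z` competes for the infimum; by `hqz` it gains an eighth of the quadratic form
    -- at y k − y n, which the two errors must therefore dominate.
    have h2 : m ≤ (1 - 1 / 2) * (m + 1 / ((n : ℝ) + 1) - q (y n)) +
        1 / 2 * (m + 1 / ((k : ℝ) + 1) - q (y k)) + q z := by
      refine csInf_le hTbdd ⟨z, ?_⟩
      rw [add_sub_cancel_right]; exact h1
    have h3 := hMc (y k - y n)
    rw [norm_sub_rev] at h3
    rw [hqz] at h2
    linarith
  have hcauchy : CauchySeq y := by
    rw [Metric.cauchySeq_iff']
    intro δ hδ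
    obtain ⟨N, hN⟩ := exists_nat_one_div_lt (show 0 < c * δ ^ 2 / 8 by positivity)
    refine ⟨N, fun n hn => ?_⟩
    have h1 := hpar n N
    have h2 : 1 / ((n : ℝ) + 1) ≤ 1 / ((N : ℝ) + 1) := Nat.one_div_le_one_div hn
    have h3 : c / 4 * ‖y n - y N‖ ^ 2 < c / 4 * δ ^ 2 := by linarith
    rw [dist_eq_norm]
    exact lt_of_pow_lt_pow_left₀ 2 hδ.le (lt_of_mul_lt_mul_left h3 (by positivity))
  obtain ⟨p, hp⟩ := cauchySeq_tendsto_of_complete hcauchy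
  have hle : h p ≤ ((m - q p : ℝ) : EReal) := by
    refine hh.le_of_weakTendsto atTop y p _ _ (WeakTendsto.of_tendsto hp) ?_ hy
    have h1 : Tendsto (fun n : ℕ => m + 1 / ((n : ℝ) + 1)) atTop (𝓝 (m + 0)) :=
      tendsto_const_nhds.add tendsto_one_div_add_atTop_nhds_zero_nat
    rw [add_zero] at h1
    exact h1.sub ((hqcont.tendsto p).comp hp)
  refine ⟨p, fun z _ => ?_⟩
  change h p + (q p : EReal) ≤ h z + (q z : EReal)
  have h1 : h p + (q p : EReal) ≤ m := by
    refine (add_le_add_left hle _).trans ?_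
    norm_cast; linarith
  refine h1.trans ?_
  by_cases hz : h z = ⊤
  · rw [hz, EReal.top_add_coe]; exact le_top
  · obtain ⟨b, hb⟩ : ∃ b : ℝ, h z = b := ⟨_, (EReal.coe_toReal hz (hh.ne_bot z)).symm⟩
    rw [hb]
    norm_cast
    exact csInf_le hTbdd ⟨z, by rw [hb, add_sub_cancel_right]⟩

end Prox

end ConvexFunctions

/-! ### Smooth convex functions and differentiability of the expected loss. -/

section SmoothFunctions

variable {E : Type*} [NormedAddCommGroup E] [InnerProductSpace ℝ E]

section QuadraticBound

variable {F : E → ℝ} {B : E → E} {β : ℝ}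

/-- Along x + t(y − x) the quadratic error is of order t², so it disappears when the convexity
inequality is divided by t and t → 0. -/
theorem gradient_inequality_of_quadratic_bound (hF : ConvexOn ℝ Set.univ F)
    (hB : ∀ x y, |F y - F x - inner ℝ (B x) (y - x)| ≤ 1 / (2 * β) * ‖y - x‖ ^ 2) (x y : E) :
    F x + inner ℝ (B x) (y - x) ≤ F y := by
  have hineq : ∀ t ∈ Set.Ioo (0 : ℝ) 1,
      inner ℝ (B x) (y - x) - t * (1 / (2 * β) * ‖y - x‖ ^ 2) ≤ F y - F x := by
    intro t ht
    have h1 := hF.2 (Set.mem_univ x) (Set.mem_univ y) (sub_nonneg.2 ht.2.le) ht.1.le (by ring)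
    have e : (1 - t) • x + t • y = x + t • (y - x) := by module
    have h2 := (abs_le.1 (hB x (x + t • (y - x)))).1
    rw [add_sub_cancel_left, norm_smul, Real.norm_of_nonneg ht.1.le, inner_smul_right] at h2
    rw [e] at h1
    simp only [smul_eq_mul] at h1
    have h3 : t * (inner ℝ (B x) (y - x) - t * (1 / (2 * β) * ‖y - x‖ ^ 2)) ≤
        t * (F y - F x) := by nlinarith
    exact le_of_mul_le_mul_left h3 ht.1
  have hlim : Tendsto (fun t : ℝ => inner ℝ (B x) (y - x) - t * (1 / (2 * β) * ‖y - x‖ ^ 2))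
      (𝓝[>] 0) (𝓝 (inner ℝ (B x) (y - x))) := by
    have : Tendsto (fun t : ℝ => inner ℝ (B x) (y - x) - t * (1 / (2 * β) * ‖y - x‖ ^ 2))
        (𝓝 0) (𝓝 (inner ℝ (B x) (y - x) - 0 * (1 / (2 * β) * ‖y - x‖ ^ 2))) :=
      Continuous.tendsto (by fun_prop) 0
    rw [zero_mul, sub_zero] at this
    exact this.mono_left nhdsWithin_le_nhds
  have := le_of_tendsto hlim (eventually_of_mem (Ioo_mem_nhdsGT (zero_lt_one' ℝ)) hineq)
  linarith

/-- **Baillon–Haddad**: the gradient of a convex function with a quadratic upper bound is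
cocoercive. -/
theorem cocoercive_of_quadratic_bound (hβ : 0 < β) (hF : ConvexOn ℝ Set.univ F)
    (hB : ∀ x y, |F y - F x - inner ℝ (B x) (y - x)| ≤ 1 / (2 * β) * ‖y - x‖ ^ 2) (x y : E) :
    β * ‖B x - B y‖ ^ 2 ≤ inner ℝ (B x - B y) (x - y) := by
  have key : ∀ x y, β / 2 * ‖B x - B y‖ ^ 2 ≤ F y - F x - inner ℝ (B x) (y - x) := by
    intro x y
    -- The minimizer of the quadratic upper bound, centred at `y`, for F − ⟪B x, ·⟫; that function
    -- is itself minimal at `x`.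
    set z := y - β • (B y - B x) with hz
    have h1 := gradient_inequality_of_quadratic_bound hF hB x z
    have h2 := (abs_le.1 (hB y z)).2
    have e1 : z - y = -(β • (B y - B x)) := by rw [hz]; abel
    have e2 : z - x = (y - x) + -(β • (B y - B x)) := by rw [hz]; abel
    rw [e1, norm_neg, norm_smul, Real.norm_of_nonneg hβ.le, inner_neg_right, inner_smul_right] at h2
    rw [e2, inner_add_right, inner_neg_right, inner_smul_right] at h1
    have h3 : inner ℝ (B y) (B y - B x) - inner ℝ (B x) (B y - B x) = ‖B y - B x‖ ^ 2 := by
      rw [← inner_sub_left, real_inner_self_eq_norm_sq]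
    have h4 : 1 / (2 * β) * (β * ‖B y - B x‖) ^ 2 = β / 2 * ‖B y - B x‖ ^ 2 := by
      field_simp
    rw [h4] at h2
    rw [norm_sub_rev]
    nlinarith
  have h1 := key x y
  have h2 := key y x
  rw [norm_sub_rev (B y)] at h2
  have h3 : inner ℝ (B x - B y) (x - y) = -inner ℝ (B x) (y - x) - inner ℝ (B y) (x - y) := by
    rw [inner_sub_left, ← neg_sub y x, inner_neg_right, inner_neg_right]
  linarith

/-- As t → 0 uniform convexity improves the gradient inequality at `x` by the modulus; adding the
plain gradient inequality at `y` turns this into a strengthened monotonicity of `B`. -/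
theorem UniformlyConvexAt.exists_modulus_le_inner {x : E} (hu : UniformlyConvexAt F x)
    (hB : ∀ x y, F x + inner ℝ (B x) (y - x) ≤ F y) :
    ∃ φ : ℝ → ℝ, MonotoneOn φ (Set.Ici 0) ∧ (∀ r : ℝ, 0 < r → 0 < φ r) ∧
      ∀ y, φ ‖y - x‖ ≤ inner ℝ (B y - B x) (y - x) := by
  obtain ⟨φ, hmono, -, hpos, hφ⟩ := hu
  refine ⟨φ, hmono, hpos, fun y => ?_⟩
  have hineq : ∀ t ∈ Set.Ioo (0 : ℝ) 1,
      inner ℝ (B x) (y - x) + (1 - t) * φ ‖y - x‖ ≤ F y - F x := by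
    intro t ht
    have h1 := hφ y (1 - t) ⟨by linarith [ht.2], by linarith [ht.1]⟩
    have h2 := hB x ((1 - t) • x + (1 - (1 - t)) • y)
    have e : (1 - t) • x + (1 - (1 - t)) • y - x = t • (y - x) := by module
    rw [e, inner_smul_right] at h2
    rw [norm_sub_rev] at h1
    have h3 : t * (inner ℝ (B x) (y - x) + (1 - t) * φ ‖y - x‖) ≤ t * (F y - F x) := by
      nlinarith
    exact le_of_mul_le_mul_left h3 ht.1
  have hlim : Tendsto (fun t : ℝ => inner ℝ (B x) (y - x) + (1 - t) * φ ‖y - x‖)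
      (𝓝[>] 0) (𝓝 (inner ℝ (B x) (y - x) + φ ‖y - x‖)) := by
    have : Tendsto (fun t : ℝ => inner ℝ (B x) (y - x) + (1 - t) * φ ‖y - x‖)
        (𝓝 0) (𝓝 (inner ℝ (B x) (y - x) + (1 - 0) * φ ‖y - x‖)) :=
      Continuous.tendsto (by fun_prop) 0
    rw [sub_zero, one_mul] at this
    exact this.mono_left nhdsWithin_le_nhds
  have h1 := le_of_tendsto hlim (eventually_of_mem (Ioo_mem_nhdsGT (zero_lt_one' ℝ)) hineq)
  have h2 := hB y x
  have h3 : inner ℝ (B y) (x - y) = - inner ℝ (B y) (y - x) := by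
    rw [← inner_neg_right, neg_sub]
  rw [inner_sub_left]
  linarith

end QuadraticBound

variable [CompleteSpace E]

/-- The first-order remainder at x + td has derivative of size at most L t ‖d‖², and is compared
with L t² ‖d‖² / 2 on [0, 1]. -/
theorem abs_sub_sub_inner_gradient_le {l : E → ℝ} {L : ℝ} (hl : Differentiable ℝ l)
    (hlip : ∀ x y, ‖gradient l x - gradient l y‖ ≤ L * ‖x - y‖) (x y : E) :
    |l y - l x - inner ℝ (gradient l x) (y - x)| ≤ L / 2 * ‖y - x‖ ^ 2 := by
  set d := y - x with hd
  set φ : ℝ → ℝ := fun t => l (x + t • d) - l x - t * inner ℝ (gradient l x) d with hφ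
  have hderiv : ∀ t, HasDerivAt φ (inner ℝ (gradient l (x + t • d) - gradient l x) d) t := by
    intro t
    have h1 : HasDerivAt (fun t : ℝ => x + t • d) d t := by
      simpa using ((hasDerivAt_id t).smul_const d).const_add x
    have h2 := (hl (x + t • d)).hasFDerivAt.comp_hasDerivAt t h1
    have h3 : (fderiv ℝ l (x + t • d)) d = inner ℝ (gradient l (x + t • d)) d := by
      rw [inner_gradient_left]
    rw [h3] at h2
    have h4 := (h2.sub_const (l x)).sub ((hasDerivAt_id t).mul_const (inner ℝ (gradient l x) d))
    rw [one_mul, ← inner_sub_left] at h4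
    exact h4
  have hmain := image_norm_le_of_norm_deriv_right_le_deriv_boundary (f := φ) (a := 0) (b := 1)
    (B := fun t => L / 2 * ‖d‖ ^ 2 * t ^ 2) (B' := fun t => L / 2 * ‖d‖ ^ 2 * (2 * t))
    (fun t _ => (hderiv t).continuousAt.continuousWithinAt)
    (fun t _ => (hderiv t).hasDerivWithinAt) (by simp [hφ])
    (fun t => by simpa using (hasDerivAt_pow 2 t).const_mul (L / 2 * ‖d‖ ^ 2))
    (fun t ht => by
      refine (norm_inner_le_norm _ _).trans ?_
      have h1 := hlip (x + t • d) x
      rw [add_sub_cancel_left, norm_smul, Real.norm_of_nonneg ht.1] at h1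
      calc _ ≤ L * (t * ‖d‖) * ‖d‖ := mul_le_mul_of_nonneg_right h1 (norm_nonneg _)
        _ = _ := by ring)
    (Set.right_mem_Icc.2 zero_le_one)
  simpa [hφ, hd] using hmain

/-- Nonnegativity of `l` at the gradient step x − β∇l(x) limits how large the gradient can be. This
lets integrability of the loss control the gradients. -/
theorem norm_gradient_sq_le {l : E → ℝ} {β : ℝ} (hβ : 0 < β) (hl : Differentiable ℝ l)
    (hnonneg : ∀ x, 0 ≤ l x)
    (hlip : ∀ x y, ‖gradient l x - gradient l y‖ ≤ 1 / β * ‖x - y‖) (x : E) :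
    ‖gradient l x‖ ^ 2 ≤ 2 / β * l x := by
  have h1 := (abs_le.1 (abs_sub_sub_inner_gradient_le hl hlip x (x - β • gradient l x))).2
  rw [sub_sub_cancel_left, inner_neg_right, inner_smul_right, real_inner_self_eq_norm_sq,
    norm_neg, norm_smul, Real.norm_of_nonneg hβ.le] at h1
  have h2 := hnonneg (x - β • gradient l x)
  have h3 : 1 / β / 2 * (β * ‖gradient l x‖) ^ 2 = β / 2 * ‖gradient l x‖ ^ 2 := by
    field_simp
  have h4 : β / 2 * ‖gradient l x‖ ^ 2 ≤ l x := by linarith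
  calc ‖gradient l x‖ ^ 2 = 2 / β * (β / 2 * ‖gradient l x‖ ^ 2) := by field_simp
    _ ≤ _ := mul_le_mul_of_nonneg_left h4 (by positivity)

variable {Ξ : Type*} [MeasurableSpace Ξ] {ρ : Measure Ξ} [IsProbabilityMeasure ρ]
  {ℓ : Ξ → E → ℝ} {β : ℝ}

/-- Pairings with the gradient are measurable in ξ as limits of difference quotients of the loss,
and are dominated because ‖∇ℓ‖ ≤ (‖∇ℓ‖² + 1)/2 ≤ ℓ/β + 1/2. -/
theorem integrable_inner_gradient (hβ : 0 < β) (hnonneg : ∀ ξ w, 0 ≤ ℓ ξ w)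
    (hint : ∀ w, Integrable (fun ξ => ℓ ξ w) ρ) (hdiff : ∀ ξ, Differentiable ℝ (ℓ ξ))
    (hlip : ∀ ξ w₁ w₂, ‖gradient (ℓ ξ) w₁ - gradient (ℓ ξ) w₂‖ ≤ (1 / β) * ‖w₁ - w₂‖) (x d : E) :
    Integrable (fun ξ => inner ℝ (gradient (ℓ ξ) x) d) ρ ∧
      |∫ ξ, inner ℝ (gradient (ℓ ξ) x) d ∂ρ| ≤ (∫ ξ, (1 / β * ℓ ξ x + 1 / 2) ∂ρ) * ‖d‖ := by
  have hmeas : AEStronglyMeasurable (fun ξ => inner ℝ (gradient (ℓ ξ) x) d) ρ := by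
    refine aestronglyMeasurable_of_tendsto_ae atTop
      (f := fun (n : ℕ) ξ => ((n : ℝ) + 1) * (ℓ ξ (x + (1 / ((n : ℝ) + 1)) • d) - ℓ ξ x))
      (fun n => (((hint _).sub (hint _)).const_mul _).aestronglyMeasurable) ?_
    refine ae_of_all _ fun ξ => ?_
    have h0 : Tendsto (fun n : ℕ => 1 / β / 2 * ‖d‖ ^ 2 * (1 / ((n : ℝ) + 1))) atTop (𝓝 0) := by
      have := tendsto_one_div_add_atTop_nhds_zero_nat.const_mul (1 / β / 2 * ‖d‖ ^ 2)
      rwa [mul_zero] at this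
    refine tendsto_iff_norm_sub_tendsto_zero.2 (squeeze_zero (fun _ => norm_nonneg _)
      (fun n => ?_) h0)
    have h1 := abs_sub_sub_inner_gradient_le (hdiff ξ) (hlip ξ) x (x + (1 / ((n : ℝ) + 1)) • d)
    have hn : (0 : ℝ) < (n : ℝ) + 1 := by positivity
    rw [add_sub_cancel_left, inner_smul_right, norm_smul, Real.norm_of_nonneg (by positivity)] at h1
    have h2 := mul_le_mul_of_nonneg_left h1 hn.le
    rw [← abs_of_pos hn, ← abs_mul, abs_of_pos hn] at h2
    refine le_of_eq_of_le (congrArg _ ?_) (h2.trans_eq ?_)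
    · field_simp
    · field_simp
  have hdom : Integrable (fun ξ => (1 / β * ℓ ξ x + 1 / 2) * ‖d‖) ρ :=
    (((hint x).const_mul _).add (integrable_const _)).mul_const _
  have hle : ∀ ξ, ‖inner ℝ (gradient (ℓ ξ) x) d‖ ≤ (1 / β * ℓ ξ x + 1 / 2) * ‖d‖ := by
    intro ξ
    refine (norm_inner_le_norm _ _).trans (mul_le_mul_of_nonneg_right ?_ (norm_nonneg _))
    have h1 := norm_gradient_sq_le hβ (hdiff ξ) (hnonneg ξ) (hlip ξ) x
    have h2 : 2 / β * ℓ ξ x = 2 * (1 / β * ℓ ξ x) := by ring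
    nlinarith [sq_nonneg (‖gradient (ℓ ξ) x‖ - 1)]
  refine ⟨hdom.mono' hmeas (ae_of_all _ hle), ?_⟩
  rw [← integral_mul_const]
  exact (norm_integral_le_integral_norm _).trans
    (integral_mono_of_nonneg (ae_of_all _ fun _ => norm_nonneg _) hdom (ae_of_all _ hle))

/-- The expected loss is differentiable and satisfies the two-sided quadratic bound. -/
theorem expectedLoss_quadratic_bound (hβ : 0 < β) (hnonneg : ∀ ξ w, 0 ≤ ℓ ξ w)
    (hint : ∀ w, Integrable (fun ξ => ℓ ξ w) ρ) (hdiff : ∀ ξ, Differentiable ℝ (ℓ ξ))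
    (hlip : ∀ ξ w₁ w₂, ‖gradient (ℓ ξ) w₁ - gradient (ℓ ξ) w₂‖ ≤ (1 / β) * ‖w₁ - w₂‖) (x y : E) :
    |expectedLoss ρ ℓ y - expectedLoss ρ ℓ x - inner ℝ (gradient (expectedLoss ρ ℓ) x) (y - x)| ≤
      1 / (2 * β) * ‖y - x‖ ^ 2 := by
  have hI := integrable_inner_gradient hβ hnonneg hint hdiff hlip x
  -- The candidate gradient is the Riesz representative of a functional made of scalar integrals, so
  -- strong measurability of ξ ↦ ∇ℓ(ξ, x) is never required.
  set T : StrongDual ℝ E := LinearMap.mkContinuous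
    { toFun := fun d => ∫ ξ, inner ℝ (gradient (ℓ ξ) x) d ∂ρ
      map_add' := fun d e => by
        simp only [inner_add_right]
        exact integral_add (hI d).1 (hI e).1
      map_smul' := fun r d => by
        simp only [inner_smul_right, integral_const_mul, RingHom.id_apply, smul_eq_mul] }
    (∫ ξ, (1 / β * ℓ ξ x + 1 / 2) ∂ρ) (fun d => (hI d).2) with hT
  have hTapp : ∀ d, T d = ∫ ξ, inner ℝ (gradient (ℓ ξ) x) d ∂ρ := fun d => rfl
  have hq : ∀ y, |expectedLoss ρ ℓ y - expectedLoss ρ ℓ x - T (y - x)| ≤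
      1 / (2 * β) * ‖y - x‖ ^ 2 := by
    intro y
    have e : expectedLoss ρ ℓ y - expectedLoss ρ ℓ x - T (y - x) =
        ∫ ξ, (ℓ ξ y - ℓ ξ x - inner ℝ (gradient (ℓ ξ) x) (y - x)) ∂ρ := by
      rw [hTapp, expectedLoss, expectedLoss, ← integral_sub (hint y) (hint x)]
      exact (integral_sub ((hint y).sub (hint x)) (hI _).1).symm
    rw [e]
    have := norm_integral_le_of_norm_le_const (μ := ρ)
      (f := fun ξ => ℓ ξ y - ℓ ξ x - inner ℝ (gradient (ℓ ξ) x) (y - x))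
      (C := 1 / (2 * β) * ‖y - x‖ ^ 2)
      (ae_of_all _ fun ξ => by
        have h1 := abs_sub_sub_inner_gradient_le (hdiff ξ) (hlip ξ) x y
        rwa [div_div, mul_comm β 2] at h1)
    simpa using this
  have hgrad : HasGradientAt (expectedLoss ρ ℓ) ((InnerProductSpace.toDual ℝ E).symm T) x := by
    rw [hasGradientAt_iff_isLittleO]
    have h1 : (fun y => expectedLoss ρ ℓ y - expectedLoss ρ ℓ x -
        inner ℝ ((InnerProductSpace.toDual ℝ E).symm T) (y - x)) =O[𝓝 x]
        fun y => ‖y - x‖ ^ 2 := by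
      refine Asymptotics.IsBigO.of_bound (1 / (2 * β)) (Eventually.of_forall fun y => ?_)
      rw [InnerProductSpace.toDual_symm_apply, norm_pow, norm_norm]
      exact hq y
    refine h1.trans_isLittleO ?_
    have h2 : Tendsto (fun y => ‖y - x‖) (𝓝 x) (𝓝 0) := by
      have : Continuous fun y => ‖y - x‖ := by fun_prop
      simpa using this.tendsto x
    have h3 := (Asymptotics.isLittleO_pow_id (𝕜 := ℝ) one_lt_two).comp_tendsto h2
    exact Asymptotics.isLittleO_norm_right.1 h3
  rw [hgrad.gradient, InnerProductSpace.toDual_symm_apply]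
  exact hq y

end SmoothFunctions

/-! ### Existence, location and measurability of weak limits. -/

section WeakLimits

variable {E : Type*} [NormedAddCommGroup E] [InnerProductSpace ℝ E] [CompleteSpace E]

/-- Banach–Alaoglu transported by Riesz. Ultrafilters replace subsequences, which dispenses with any
separability argument. -/
theorem exists_weakTendsto_ultrafilter {x : ℕ → E} {C : ℝ} (hC : ∀ n, ‖x n‖ ≤ C)
    (U : Ultrafilter ℕ) : ∃ x₀, WeakTendsto x U x₀ := by
  let f : ℕ → WeakDual ℝ E := fun n =>
    StrongDual.toWeakDual (InnerProductSpace.toDual ℝ E (x n))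
  have hf : ((U.map f : Ultrafilter (WeakDual ℝ E)) : Filter (WeakDual ℝ E)) ≤
      𝓟 (WeakDual.toStrongDual ⁻¹' Metric.closedBall (0 : StrongDual ℝ E) C) := by
    refine le_principal_iff.2 (Filter.mem_map.2 (univ_mem' fun n => ?_))
    change dist (InnerProductSpace.toDual ℝ E (x n)) 0 ≤ C
    rw [dist_zero_right, LinearIsometryEquiv.norm_map]
    exact hC n
  obtain ⟨φ, -, hφ⟩ := (WeakDual.isCompact_closedBall (0 : StrongDual ℝ E) C).ultrafilter_le_nhds
    (U.map f) hf
  refine ⟨(InnerProductSpace.toDual ℝ E).symm (WeakDual.toStrongDual φ), fun y => ?_⟩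
  have h1 : Tendsto f U (𝓝 φ) := hφ
  have h2 := ((WeakDual.eval_continuous y).tendsto φ).comp h1
  have h3 : inner ℝ y ((InnerProductSpace.toDual ℝ E).symm (WeakDual.toStrongDual φ)) = φ y := by
    rw [real_inner_comm, InnerProductSpace.toDual_symm_apply]; rfl
  rw [h3]
  refine h2.congr fun n => ?_
  rw [real_inner_comm]; rfl

/-- A closed subspace is the set of vectors orthogonal to Kᗮ, a condition that weak limits preserve.
-/
theorem mem_of_weakTendsto {K : Submodule ℝ E} (hK : IsClosed (K : Set E)) {x : ℕ → E}
    {l : Filter ℕ} [l.NeBot] {x₀ : E} (h : WeakTendsto x l x₀) (hx : ∀ n, x n ∈ K) : x₀ ∈ K := by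
  have : CompleteSpace K := hK.completeSpace_coe
  rw [← Submodule.orthogonal_orthogonal K]
  intro y hy
  refine tendsto_nhds_unique (h y) ?_
  have : (fun n => inner ℝ y (x n)) = fun _ => (0 : ℝ) := by
    funext n
    rw [real_inner_comm]
    exact hy (x n) (hx n)
  rw [this]
  exact tendsto_const_nhds

variable {Ω : Type*} {m0 : MeasurableSpace Ω} {P : Measure Ω}

/-- Almost sure weak limits of strongly measurable sequences are strongly measurable. -/
theorem exists_stronglyMeasurable_weak_limit {x : ℕ → Ω → E}
    (hx : ∀ n, StronglyMeasurable (x n))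
    (hlim : ∀ᵐ ω ∂P, ∃ x₀, WeakTendsto (fun n => x n ω) atTop x₀) :
    ∃ y : Ω → E, StronglyMeasurable y ∧
      ∀ᵐ ω ∂P, WeakTendsto (fun n => x n ω) atTop (y ω) := by
  classical
  choose! y hy using fun ω (h : ∃ x₀, WeakTendsto (fun n => x n ω) atTop x₀) => h
  have hy' : ∀ᵐ ω ∂P, WeakTendsto (fun n => x n ω) atTop (y ω) := by
    filter_upwards [hlim] with ω hω using hy ω hω
  suffices hm : AEStronglyMeasurable y P by
    refine ⟨hm.mk y, hm.stronglyMeasurable_mk, ?_⟩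
    filter_upwards [hy', hm.ae_eq_mk] with ω h1 h2
    rwa [← h2]
  obtain ⟨c, hc, hcx⟩ : TopologicalSpace.IsSeparable (⋃ n, Set.range (x n)) :=
    TopologicalSpace.IsSeparable.iUnion fun n => (hx n).isSeparable_range
  obtain ⟨d, hd⟩ := (hc.insert 0).exists_eq_range ⟨0, Set.mem_insert _ _⟩
  -- The ambient space may be nonseparable, but all values lie in the closure of the increasing
  -- union of these finite-dimensional spaces. The projection of the weak limit to `U N` has
  -- finitely many coordinates, each a limit of measurable functions, and these projections converge
  -- strongly to the weak limit.
  let U : ℕ → Submodule ℝ E := fun N => Submodule.span ℝ (d '' Set.Iic N)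
  have hUfin : ∀ N, FiniteDimensional ℝ (U N) := fun N =>
    FiniteDimensional.span_of_finite ℝ ((Set.finite_Iic N).image d)
  have hUmono : Monotone U := fun M N h =>
    Submodule.span_mono (Set.image_mono (Set.Iic_subset_Iic.2 h))
  let T : Submodule ℝ E := (⨆ N, U N).topologicalClosure
  have hTclosed : IsClosed (T : Set E) := Submodule.isClosed_topologicalClosure _
  have : CompleteSpace T := hTclosed.completeSpace_coe
  have hdT : Set.range d ⊆ T := by
    rintro _ ⟨n, rfl⟩
    refine Submodule.le_topologicalClosure _ (Submodule.mem_iSup_of_mem n ?_)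
    exact Submodule.subset_span ⟨n, Set.mem_Iic.2 le_rfl, rfl⟩
  have hxT : ∀ n ω, x n ω ∈ T := fun n ω => by
    have h1 : x n ω ∈ closure c := hcx (Set.mem_iUnion.2 ⟨n, ω, rfl⟩)
    exact closure_minimal (((Set.subset_insert _ _).trans hd.subset).trans hdT) hTclosed h1
  refine aestronglyMeasurable_of_tendsto_ae atTop (f := fun N ω => (U N).starProjection (y ω)) ?_ ?_
  · intro N
    have := hUfin N
    let b := stdOrthonormalBasis ℝ (U N)
    have hrep : ∀ v, (U N).starProjection v = ∑ i, inner ℝ (b i : E) v • (b i : E) := by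
      intro v
      rw [b.starProjection_eq_sum_rankOne]
      simp
    simp only [hrep]
    refine Finset.aestronglyMeasurable_fun_sum _ fun i _ => AEStronglyMeasurable.smul_const ?_ _
    refine aestronglyMeasurable_of_tendsto_ae atTop (f := fun n ω => inner ℝ (b i : E) (x n ω))
      (fun n => (stronglyMeasurable_const.inner (hx n)).aestronglyMeasurable) ?_
    filter_upwards [hy'] with ω hω using hω _
  · filter_upwards [hy'] with ω hω
    have h1 := Submodule.starProjection_tendsto_closure_iSup U hUmono (y ω)
    rwa [Submodule.starProjection_eq_self_iff.2
      (mem_of_weakTendsto hTclosed hω fun n => hxT n ω)] at h1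

end WeakLimits

/-! ### The Robbins–Siegmund almost supermartingale theorem. -/

section RobbinsSiegmund

variable {Ω : Type*} {m0 : MeasurableSpace Ω} {P : Measure Ω} [IsFiniteMeasure P]
  {ℱ : Filtration ℕ m0} {Y X η : ℕ → Ω → ℝ}

/-- Robbins–Siegmund convergence when the perturbations have uniformly bounded sums. -/
theorem ae_tendsto_and_summable_of_sum_le {K : ℝ} (hK : 0 ≤ K)
    (hYm : ∀ n, StronglyMeasurable[ℱ n] (Y n)) (hYi : ∀ n, Integrable (Y n) P)
    (hY : ∀ n ω, 0 ≤ Y n ω)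
    (hXm : ∀ n, StronglyMeasurable[ℱ n] (X n)) (hXi : ∀ n, Integrable (X n) P)
    (hX : ∀ n ω, 0 ≤ X n ω)
    (hηm : ∀ n, StronglyMeasurable[ℱ n] (η n)) (hηi : ∀ n, Integrable (η n) P)
    (hη : ∀ n ω, 0 ≤ η n ω)
    (hsum : ∀ n ω, ∑ i ∈ Finset.range n, η i ω ≤ K)
    (h : ∀ n, P[Y (n + 1) | ℱ n] ≤ᵐ[P] fun ω => Y n ω - X n ω + η n ω) :
    ∀ᵐ ω ∂P, (∃ l, Tendsto (fun n => Y n ω) atTop (𝓝 l)) ∧ Summable fun n => X n ω := by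
  -- Adding back the accumulated decrease and removing the accumulated perturbation leaves a
  -- supermartingale, bounded below by −K.
  set M : ℕ → Ω → ℝ := fun n => Y n + ∑ i ∈ Finset.range n, (X i - η i) with hM
  have hSm : ∀ n k, n ≤ k + 1 → StronglyMeasurable[ℱ k] (∑ i ∈ Finset.range n, (X i - η i)) := by
    intro n k hnk
    refine Finset.stronglyMeasurable_sum _ fun i hi => ?_
    have hik : i ≤ k := by have := Finset.mem_range.1 hi; omega
    exact ((hXm i).mono (ℱ.mono hik)).sub ((hηm i).mono (ℱ.mono hik))
  have hSi : ∀ n, Integrable (∑ i ∈ Finset.range n, (X i - η i)) P := fun n =>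
    integrable_finsetSum' _ fun i _ => (hXi i).sub (hηi i)
  have hMi : ∀ n, Integrable (M n) P := fun n => (hYi n).add (hSi n)
  have hsuper : Supermartingale M ℱ P := by
    refine supermartingale_nat (fun n => (hYm n).add (hSm n n (by omega))) hMi fun n => ?_
    have h1 : P[M (n + 1) | ℱ n] =ᵐ[P] P[Y (n + 1) | ℱ n] +
        P[∑ i ∈ Finset.range (n + 1), (X i - η i) | ℱ n] :=
      condExp_add (hYi (n + 1)) (hSi (n + 1)) _
    rw [condExp_of_stronglyMeasurable (ℱ.le n) (hSm (n + 1) n le_rfl) (hSi (n + 1))] at h1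
    filter_upwards [h1, h n] with ω h1 h2
    rw [h1]
    simp only [hM, Pi.add_apply, Finset.sum_range_succ, Pi.sub_apply] at *
    linarith
  have hlow : ∀ n ω, -K ≤ M n ω := by
    intro n ω
    have h1 : 0 ≤ ∑ i ∈ Finset.range n, X i ω := Finset.sum_nonneg fun i _ => hX i ω
    have h2 := hY n ω
    have h3 := hsum n ω
    simp only [hM, Pi.add_apply, Finset.sum_apply, Pi.sub_apply, Finset.sum_sub_distrib]
    linarith
  have hbdd : ∀ n, eLpNorm ((-M) n) 1 P ≤
      ((∫ ω, M 0 ω ∂P) + 2 * K * P.real Set.univ).toNNReal := by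
    intro n
    rw [Pi.neg_apply, eLpNorm_neg, eLpNorm_one_eq_lintegral_enorm,
      ← ofReal_integral_norm_eq_lintegral_enorm (hMi n)]
    refine ENNReal.ofReal_le_ofReal ?_
    -- From M ≥ −K one has |M| ≤ M + 2K, so decreasing expectations give a uniform L¹ bound.
    have h1 : ∫ ω, ‖M n ω‖ ∂P ≤ ∫ ω, (M n ω + 2 * K) ∂P := by
      refine integral_mono (hMi n).norm ((hMi n).add (integrable_const _)) fun ω => ?_
      have := hlow n ω
      rw [Real.norm_eq_abs]
      exact abs_le.2 ⟨by linarith, by linarith⟩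
    have h2 : ∫ ω, M n ω ∂P ≤ ∫ ω, M 0 ω ∂P := by
      simpa using hsuper.setIntegral_le (Nat.zero_le n) (s := Set.univ) MeasurableSet.univ
    rw [integral_add (hMi n) (integrable_const _), integral_const, smul_eq_mul] at h1
    linarith
  filter_upwards [hsuper.neg.exists_ae_tendsto_of_bdd hbdd] with ω hω
  obtain ⟨c, hc⟩ := hω
  have hMc : Tendsto (fun n => M n ω) atTop (𝓝 (-c)) := by simpa using hc.neg
  have hηs : Summable fun n => η n ω :=
    summable_of_sum_range_le (fun n => hη n ω) fun n => hsum n ω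
  obtain ⟨B, hB⟩ := hMc.bddAbove_range
  have hXs : Summable fun n => X n ω := by
    refine summable_of_sum_range_le (c := B + K) (fun n => hX n ω) fun n => ?_
    have h1 : M n ω ≤ B := hB ⟨n, rfl⟩
    have h2 := hY n ω
    have h3 := hsum n ω
    simp only [hM, Pi.add_apply, Finset.sum_apply, Pi.sub_apply, Finset.sum_sub_distrib] at h1
    linarith
  refine ⟨⟨-c - (∑' n, X n ω - ∑' n, η n ω), ?_⟩, hXs⟩
  refine (hMc.sub ((hXs.hasSum.tendsto_sum_nat).sub (hηs.hasSum.tendsto_sum_nat))).congr fun n => ?_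
  simp [hM, Finset.sum_sub_distrib]

/-- Robbins–Siegmund convergence for almost supermartingales without multiplicative factor. -/
theorem ae_tendsto_and_summable_of_condExp_le_add
    (hYm : ∀ n, StronglyMeasurable[ℱ n] (Y n)) (hYi : ∀ n, Integrable (Y n) P)
    (hY : ∀ n ω, 0 ≤ Y n ω)
    (hXm : ∀ n, StronglyMeasurable[ℱ n] (X n)) (hXi : ∀ n, Integrable (X n) P)
    (hX : ∀ n ω, 0 ≤ X n ω)
    (hηm : ∀ n, StronglyMeasurable[ℱ n] (η n)) (hηi : ∀ n, Integrable (η n) P)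
    (hη : ∀ n ω, 0 ≤ η n ω)
    (hsum : ∀ᵐ ω ∂P, Summable fun n => η n ω)
    (h : ∀ n, P[Y (n + 1) | ℱ n] ≤ᵐ[P] fun ω => Y n ω - X n ω + η n ω) :
    ∀ᵐ ω ∂P, (∃ l, Tendsto (fun n => Y n ω) atTop (𝓝 l)) ∧ Summable fun n => X n ω := by
  -- Localization: `B K (n + 1)` involves only η 0, …, η n, so it is known at time n and its
  -- indicator passes through the conditional expectation. Almost every path stays in `B K` for some
  -- K.
  set B : ℕ → ℕ → Set Ω := fun K n => {ω | ∑ i ∈ Finset.range n, η i ω ≤ K} with hB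
  have hBm : ∀ K n, MeasurableSet[ℱ n] (B K (n + 1)) := by
    intro K n
    refine measurableSet_le (StronglyMeasurable.measurable ?_) measurable_const
    refine Finset.stronglyMeasurable_fun_sum _ fun i hi => (hηm i).mono (ℱ.mono ?_)
    have := Finset.mem_range.1 hi; omega
  have hBm' : ∀ K n, MeasurableSet[ℱ n] (B K n) := by
    intro K n
    refine measurableSet_le (StronglyMeasurable.measurable ?_) measurable_const
    refine Finset.stronglyMeasurable_fun_sum _ fun i hi => (hηm i).mono (ℱ.mono ?_)
    exact (Finset.mem_range.1 hi).le
  have hBanti : ∀ K n, B K (n + 1) ⊆ B K n := by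
    intro K n ω hω
    simp only [hB, Set.mem_ofPred_eq, Finset.sum_range_succ] at hω ⊢
    linarith [hη n ω]
  have key : ∀ K : ℕ, ∀ᵐ ω ∂P,
      (∃ l, Tendsto (fun n => (B K n).indicator (Y n) ω) atTop (𝓝 l)) ∧
        Summable fun n => (B K (n + 1)).indicator (X n) ω := by
    intro K
    refine ae_tendsto_and_summable_of_sum_le (ℱ := ℱ) (K := K)
      (η := fun n => (B K (n + 1)).indicator (η n)) (Nat.cast_nonneg K)
      (fun n => (hYm n).indicator (hBm' K n)) (fun n => (hYi n).indicator (ℱ.le n _ (hBm' K n)))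
      (fun n ω => Set.indicator_nonneg (fun _ _ => hY n _) ω)
      (fun n => (hXm n).indicator (hBm K n)) (fun n => (hXi n).indicator (ℱ.le n _ (hBm K n)))
      (fun n ω => Set.indicator_nonneg (fun _ _ => hX n _) ω)
      (fun n => (hηm n).indicator (hBm K n)) (fun n => (hηi n).indicator (ℱ.le n _ (hBm K n)))
      (fun n ω => Set.indicator_nonneg (fun _ _ => hη n _) ω) ?_ ?_
    · intro n ω
      induction n with
      | zero => simp
      | succ n ih =>
        by_cases hω : ω ∈ B K (n + 1)
        · refine le_trans (Finset.sum_le_sum fun i _ => ?_) hω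
          exact Set.indicator_le_self' (fun _ _ => hη i _) ω
        · rw [Finset.sum_range_succ, Set.indicator_of_notMem hω, add_zero]
          exact ih
    · intro n
      filter_upwards [condExp_indicator (hYi (n + 1)) (hBm K n), h n] with ω h1 h2
      rw [h1]
      by_cases hω : ω ∈ B K (n + 1)
      · simp only [Set.indicator_of_mem hω, Set.indicator_of_mem (hBanti K n hω)]
        exact h2
      · simp only [Set.indicator_of_notMem hω, sub_zero, add_zero]
        exact Set.indicator_nonneg (fun _ _ => hY n _) ω
  filter_upwards [ae_all_iff.2 key, hsum] with ω hω hs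
  obtain ⟨K, hK⟩ := exists_nat_ge (∑' n, η n ω)
  have hmem : ∀ n, ω ∈ B K n := fun n =>
    (hs.sum_le_tsum _ fun i _ => hη i ω).trans hK
  have := hω K
  simpa only [Set.indicator_of_mem (hmem _)] using this

/-- **Robbins–Siegmund theorem**, with deterministic summable multiplicative perturbations. -/
theorem ae_tendsto_and_summable_of_condExp_le {α : ℕ → ℝ} (hα : ∀ n, 0 ≤ α n) (hαs : Summable α)
    (hYm : ∀ n, StronglyMeasurable[ℱ n] (Y n)) (hYi : ∀ n, Integrable (Y n) P)
    (hY : ∀ n ω, 0 ≤ Y n ω)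
    (hXm : ∀ n, StronglyMeasurable[ℱ n] (X n)) (hXi : ∀ n, Integrable (X n) P)
    (hX : ∀ n ω, 0 ≤ X n ω)
    (hηm : ∀ n, StronglyMeasurable[ℱ n] (η n)) (hηi : ∀ n, Integrable (η n) P)
    (hη : ∀ n ω, 0 ≤ η n ω)
    (hsum : ∀ᵐ ω ∂P, Summable fun n => η n ω)
    (h : ∀ n, P[Y (n + 1) | ℱ n] ≤ᵐ[P] fun ω => (1 + α n) * Y n ω - X n ω + η n ω) :
    ∀ᵐ ω ∂P, (∃ l, Tendsto (fun n => Y n ω) atTop (𝓝 l)) ∧ Summable fun n => X n ω := by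
  -- Dividing by these products absorbs the factors 1 + α n. They lie between 1 and exp (∑ α) and
  -- converge, so the conclusions survive undoing the division.
  set p : ℕ → ℝ := fun n => ∏ i ∈ Finset.range n, (1 + α i) with hp
  have hp1 : ∀ n, 1 ≤ p n := fun n =>
    Finset.prod_induction _ (fun x : ℝ => 1 ≤ x) (fun _ _ => one_le_mul_of_one_le_of_one_le) le_rfl
      fun i _ => by linarith [hα i]
  have hp0 : ∀ n, 0 < p n := fun n => one_pos.trans_le (hp1 n)
  have hps : ∀ n, p (n + 1) = p n * (1 + α n) := fun n => Finset.prod_range_succ _ _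
  have hpmono : Monotone p := monotone_nat_of_le_succ fun n => by
    rw [hps]; nlinarith [hp0 n, hα n]
  have hpb : ∀ n, p n ≤ Real.exp (∑' i, α i) := fun n =>
    (Real.prod_one_add_le_exp_sum _ hα).trans
      (Real.exp_le_exp.2 (hαs.sum_le_tsum _ fun i _ => hα i))
  obtain ⟨q, hq⟩ : ∃ q, Tendsto p atTop (𝓝 q) :=
    ⟨_, tendsto_atTop_ciSup hpmono ⟨_, by rintro _ ⟨n, rfl⟩; exact hpb n⟩⟩
  have hinv : ∀ n, 0 ≤ (p n)⁻¹ := fun n => (inv_pos.2 (hp0 n)).le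
  have hmain := ae_tendsto_and_summable_of_condExp_le_add (P := P) (ℱ := ℱ)
    (Y := fun n ω => (p n)⁻¹ * Y n ω) (X := fun n ω => (p (n + 1))⁻¹ * X n ω)
    (η := fun n ω => (p (n + 1))⁻¹ * η n ω)
    (fun n => (hYm n).const_mul _) (fun n => (hYi n).const_mul _)
    (fun n ω => mul_nonneg (hinv _) (hY n ω))
    (fun n => (hXm n).const_mul _) (fun n => (hXi n).const_mul _)
    (fun n ω => mul_nonneg (hinv _) (hX n ω))
    (fun n => (hηm n).const_mul _) (fun n => (hηi n).const_mul _)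
    (fun n ω => mul_nonneg (hinv _) (hη n ω))
    (by
      filter_upwards [hsum] with ω hω
      refine Summable.of_nonneg_of_le (fun n => mul_nonneg (hinv _) (hη n ω)) (fun n => ?_) hω
      exact mul_le_of_le_one_left (hη n ω) (inv_le_one_of_one_le₀ (hp1 _)))
    (by
      intro n
      have h1 : P[fun ω => (p (n + 1))⁻¹ * Y (n + 1) ω | ℱ n] =ᵐ[P]
          fun ω => (p (n + 1))⁻¹ * (P[Y (n + 1) | ℱ n]) ω :=
        condExp_smul (μ := P) (p (n + 1))⁻¹ (Y (n + 1)) (ℱ n)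
      filter_upwards [h1, h n] with ω h1 h2
      rw [h1]
      calc (p (n + 1))⁻¹ * (P[Y (n + 1) | ℱ n]) ω
          ≤ (p (n + 1))⁻¹ * ((1 + α n) * Y n ω - X n ω + η n ω) :=
            mul_le_mul_of_nonneg_left h2 (hinv _)
        _ = _ := by
            have h3 : (p (n + 1))⁻¹ * (1 + α n) = (p n)⁻¹ := by
              have : (1 + α n) ≠ 0 := by linarith [hα n] |> ne_of_gt
              rw [hps]; field_simp
            rw [← h3]; ring)
  filter_upwards [hmain] with ω hω
  obtain ⟨⟨l, hl⟩, hs⟩ := hω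
  refine ⟨⟨q * l, (hq.mul hl).congr fun n => ?_⟩, ?_⟩
  · have := (hp0 n).ne'
    field_simp
  · refine Summable.of_nonneg_of_le (fun n => hX n ω) (fun n => ?_)
      (hs.mul_left (Real.exp (∑' i, α i)))
    have h1 := hpb (n + 1)
    calc X n ω = p (n + 1) * ((p (n + 1))⁻¹ * X n ω) := by
          have := (hp0 (n + 1)).ne'
          field_simp
      _ ≤ _ := mul_le_mul_of_nonneg_right h1 (mul_nonneg (hinv _) (hX n ω))

end RobbinsSiegmund

/-! ### Deterministic preconditioned forward-backward splitting. -/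

section Splitting

variable {K H : Type*} [NormedAddCommGroup K] [InnerProductSpace ℝ K]
  [NormedAddCommGroup H] [InnerProductSpace ℝ H]

/-- The data of a preconditioned forward-backward splitting for `0 ∈ A x + π† B (π x)`: `S` is the
preconditioner, `A` a weakly-strongly closed monotone relation, `R` the resolvent `(S + A)⁻¹`, and
`B` is `β`-cocoercive with `κ ‖π x‖² ≤ ⟪S x, x⟫`, where `κ β > 1 / 2`. -/
structure IsSplitting (S : K →L[ℝ] K) (π : K →L[ℝ] H) (A : K → Set K) (B : H → H) (R : K → K)
    (κ β : ℝ) : Prop where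
  symm : ∀ x y, inner ℝ (S x) y = inner ℝ x (S y)
  coercive : ∃ c : ℝ, 0 < c ∧ ∀ x, c * ‖x‖ ^ 2 ≤ inner ℝ (S x) x
  kappa_pos : 0 < κ
  beta_pos : 0 < β
  half_lt : 1 / 2 < κ * β
  norm_sq_le : ∀ x, κ * ‖π x‖ ^ 2 ≤ inner ℝ (S x) x
  cocoercive : ∀ x y, β * ‖B x - B y‖ ^ 2 ≤ inner ℝ (B x - B y) (x - y)
  monotone : ∀ x y p q, p ∈ A x → q ∈ A y → 0 ≤ inner ℝ (p - q) (x - y)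
  mem_of_weakTendsto : ∀ (U : Ultrafilter ℕ) (x p : ℕ → K) (x₀ p₀ : K) (C : ℝ),
    WeakTendsto x U x₀ → (∀ n, ‖x n‖ ≤ C) → Tendsto p U (𝓝 p₀) → (∀ n, p n ∈ A (x n)) → p₀ ∈ A x₀
  resolvent : ∀ y, y - S (R y) ∈ A (R y)

/-- The constants of the quadratic estimate behind the descent inequality. -/
theorem exists_descent_constant {κ β : ℝ} (hκ : 0 < κ) (hβ : 0 < β) (h : 1 / 2 < κ * β) :
    ∃ c : ℝ, 0 < c ∧ ∀ b r q : ℝ, κ * r ^ 2 ≤ q →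
      2 * b * r ≤ (1 - c) * q + (2 * β - c) * b ^ 2 := by
  -- The midpoint of 1/(2κβ) and 1. Young's inequality with weight θκ then leaves slack in both
  -- coefficients, and `c` is the smaller slack.
  set θ : ℝ := (1 + 1 / (2 * (κ * β))) / 2 with hθ
  have h1 : 1 / (2 * (κ * β)) < 1 := by rw [div_lt_one (by positivity)]; linarith
  have hθ1 : θ < 1 := by rw [hθ]; linarith
  have hθ2 : 1 / (2 * (κ * β)) < θ := by rw [hθ]; linarith
  have hθ0 : 0 < θ := lt_trans (by positivity) hθ2
  have h2 : 1 / (θ * κ) < 2 * β := by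
    rw [div_lt_iff₀ (by positivity)] at hθ2 ⊢
    linarith
  refine ⟨min (1 - θ) (2 * β - 1 / (θ * κ)), lt_min (by linarith) (by linarith), fun b r q hq => ?_⟩
  set c := min (1 - θ) (2 * β - 1 / (θ * κ))
  have hc1 : θ ≤ 1 - c := by linarith [min_le_left (1 - θ) (2 * β - 1 / (θ * κ))]
  have hc2 : 1 / (θ * κ) ≤ 2 * β - c := by linarith [min_le_right (1 - θ) (2 * β - 1 / (θ * κ))]
  have hq0 : 0 ≤ q := le_trans (by positivity) hq
  have h3 : 2 * b * r ≤ θ * (κ * r ^ 2) + 1 / (θ * κ) * b ^ 2 := by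
    have e : θ * (κ * r ^ 2) + 1 / (θ * κ) * b ^ 2 - 2 * b * r = (θ * κ * r - b) ^ 2 / (θ * κ) := by
      field_simp; ring
    have : 0 ≤ (θ * κ * r - b) ^ 2 / (θ * κ) := by positivity
    linarith
  have h4 : θ * (κ * r ^ 2) ≤ (1 - c) * q := by
    calc θ * (κ * r ^ 2) ≤ θ * q := mul_le_mul_of_nonneg_left hq hθ0.le
      _ ≤ _ := mul_le_mul_of_nonneg_right hc1 hq0
  have h5 := mul_le_mul_of_nonneg_right hc2 (sq_nonneg b)
  linarith

namespace IsSplitting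

variable {S : K →L[ℝ] K} {π : K →L[ℝ] H} {A : K → Set K} {B : H → H} {R : K → K} {κ β : ℝ}

theorem inner_self_nonneg (h : IsSplitting S π A B R κ β) (x : K) : 0 ≤ inner ℝ (S x) x :=
  le_trans (mul_nonneg h.kappa_pos.le (sq_nonneg _)) (h.norm_sq_le x)

theorem inner_add_smul (h : IsSplitting S π A B R κ β) (a d : K) (t : ℝ) :
    inner ℝ (S (a + t • d)) (a + t • d) =
      inner ℝ (S a) a + 2 * t * inner ℝ (S a) d + t ^ 2 * inner ℝ (S d) d :=
  inner_map_expand h.symm a d t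

theorem inner_add (h : IsSplitting S π A B R κ β) (a d : K) :
    inner ℝ (S (a + d)) (a + d) = inner ℝ (S a) a + 2 * inner ℝ (S a) d + inner ℝ (S d) d := by
  simpa using h.inner_add_smul a d 1

theorem lipschitz_B (h : IsSplitting S π A B R κ β) :
    LipschitzWith (Real.toNNReal β⁻¹) B := by
  refine LipschitzWith.of_dist_le_mul fun x y => ?_
  rw [dist_eq_norm, dist_eq_norm, Real.coe_toNNReal _ (inv_pos.2 h.beta_pos).le]
  have h1 := (h.cocoercive x y).trans (real_inner_le_norm _ _)
  rcases (norm_nonneg (B x - B y)).eq_or_lt with h0 | h0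
  · rw [← h0]; exact mul_nonneg (inv_pos.2 h.beta_pos).le (norm_nonneg _)
  · rw [inv_mul_eq_div, le_div_iff₀ h.beta_pos]
    refine le_of_mul_le_mul_left ?_ h0
    linarith

/-- Coercivity of `S` makes S + A strongly monotone. Continuity of `R` later carries measurability
and square integrability along the iteration. -/
theorem exists_lipschitz_R (h : IsSplitting S π A B R κ β) : ∃ L, LipschitzWith L R := by
  obtain ⟨c, hc, hS⟩ := h.coercive
  refine ⟨Real.toNNReal c⁻¹, LipschitzWith.of_dist_le_mul fun x y => ?_⟩
  rw [dist_eq_norm, dist_eq_norm, Real.coe_toNNReal _ (inv_pos.2 hc).le]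
  have h1 := h.monotone _ _ _ _ (h.resolvent x) (h.resolvent y)
  have e : x - S (R x) - (y - S (R y)) = (x - y) - S (R x - R y) := by rw [map_sub]; abel
  rw [e, inner_sub_left] at h1
  have h2 := hS (R x - R y)
  have h3 := real_inner_le_norm (x - y) (R x - R y)
  rcases (norm_nonneg (R x - R y)).eq_or_lt with h0 | h0
  · rw [← h0]; exact mul_nonneg (inv_pos.2 hc).le (norm_nonneg _)
  · rw [inv_mul_eq_div, le_div_iff₀ hc]
    refine le_of_mul_le_mul_left ?_ h0
    linarith

/-- The resolvent is the unique solution of its defining inclusion. -/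
theorem eq_resolvent (h : IsSplitting S π A B R κ β) {x y : K} (hx : y - S x ∈ A x) :
    x = R y := by
  obtain ⟨c, hc, hS⟩ := h.coercive
  have h1 := h.monotone _ _ _ _ hx (h.resolvent y)
  have e : y - S x - (y - S (R y)) = - S (x - R y) := by rw [map_sub]; abel
  rw [e, inner_neg_left] at h1
  have h2 := hS (x - R y)
  have h3 : ‖x - R y‖ ^ 2 = 0 := by
    refine le_antisymm ?_ (sq_nonneg _)
    by_contra! h4
    nlinarith
  exact sub_eq_zero.1 (norm_eq_zero.1 (pow_eq_zero_iff two_ne_zero |>.1 h3))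

/-- The cross term 2⟪S x, d⟫ is at most ⟪S x, x⟫ + ⟪S d, d⟫, by positivity at x − d. This isolates
the cost of inertia in the form required by Robbins–Siegmund. -/
theorem le_of_relaxation (h : IsSplitting S π A B R κ β) (x d : K) {a : ℝ} (ha : 0 ≤ a) :
    inner ℝ (S (x + a • d)) (x + a • d) ≤
      (1 + a) * inner ℝ (S x) x + (a + a ^ 2) * inner ℝ (S d) d := by
  rw [h.inner_add_smul]
  have h1 := h.inner_self_nonneg (x + (-1 : ℝ) • d)
  rw [h.inner_add_smul] at h1
  nlinarith

variable [CompleteSpace K] [CompleteSpace H]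

/-- The one-step descent inequality, comparing the step with noisy gradient `a` to the exact
step. -/
theorem exists_step_inequality (h : IsSplitting S π A B R κ β) :
    ∃ c C : ℝ, 0 < c ∧ 0 ≤ C ∧ ∀ (z x' : K) (a : H), -(π.adjoint (B (π x'))) ∈ A x' →
      inner ℝ (S (R (S z - π.adjoint a) - x')) (R (S z - π.adjoint a) - x') ≤
        inner ℝ (S (z - x')) (z - x') -
          c * (inner ℝ (S (z - R (S z - π.adjoint (B (π z))))) (z - R (S z - π.adjoint (B (π z)))) +
            ‖B (π z) - B (π x')‖ ^ 2) -
          2 * inner ℝ (a - B (π z)) (π (R (S z - π.adjoint (B (π z))) - x')) +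
          C * ‖a - B (π z)‖ ^ 2 := by
  obtain ⟨c, hc, hconst⟩ := exists_descent_constant h.kappa_pos h.beta_pos h.half_lt
  have hκ := h.kappa_pos
  -- The part 2/κ pays for the noise paired with the displacement from the exact step; c/κ, and the
  -- halving of `c`, pay for replacing the noisy residual z − p by the exact one z − t.
  refine ⟨c / 2, 2 / κ + c / κ, by positivity, by positivity, fun z x' a hx' => ?_⟩
  set p := R (S z - π.adjoint a) with hp
  set t := R (S z - π.adjoint (B (π z))) with ht
  set e := a - B (π z) with he
  set b := B (π z) - B (π x') with hb
  have hpA : S z - π.adjoint a - S p ∈ A p := h.resolvent _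
  have htA : S z - π.adjoint (B (π z)) - S t ∈ A t := h.resolvent _
  -- monotonicity against the solution
  have m1 : inner ℝ (e + b) (π (p - x')) ≤ inner ℝ (S (z - p)) (p - x') := by
    have := h.monotone _ _ _ _ hpA hx'
    have e1 : S z - π.adjoint a - S p - -(π.adjoint (B (π x'))) =
        S (z - p) - π.adjoint (e + b) := by
      simp only [he, hb, map_sub, map_add]; abel
    rw [e1, inner_sub_left, ContinuousLinearMap.adjoint_inner_left] at this
    linarith
  -- monotonicity against the exact step
  have m2 : inner ℝ (S (p - t)) (p - t) ≤ - inner ℝ e (π (p - t)) := by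
    have := h.monotone _ _ _ _ hpA htA
    have e1 : S z - π.adjoint a - S p - (S z - π.adjoint (B (π z)) - S t) =
        -(S (p - t)) - π.adjoint e := by
      simp only [he, map_sub]; abel
    rw [e1, inner_sub_left, inner_neg_left, ContinuousLinearMap.adjoint_inner_left] at this
    linarith
  have i1 : inner ℝ (S (z - x')) (z - x') = inner ℝ (S (z - p)) (z - p) +
      2 * inner ℝ (S (z - p)) (p - x') + inner ℝ (S (p - x')) (p - x') := by
    have := h.inner_add (z - p) (p - x')
    rwa [sub_add_sub_cancel] at this
  have i2 : inner ℝ b (π (p - x')) = inner ℝ b (π z - π x') - inner ℝ b (π (z - p)) := by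
    rw [← inner_sub_right, map_sub, map_sub]; congr 1; abel
  -- The exact step `t` does not depend on `a`, so the first term is harmless in conditional mean;
  -- the second is quadratic in `e`, since ‖π(p − t)‖ ≤ ‖e‖/κ.
  have i3 : inner ℝ e (π (p - x')) = inner ℝ e (π (t - x')) + inner ℝ e (π (p - t)) := by
    rw [← inner_add_right, ← map_add, add_comm, sub_add_sub_cancel]
  have c1 : β * ‖b‖ ^ 2 ≤ inner ℝ b (π z - π x') := h.cocoercive _ _
  have c2 : inner ℝ b (π (z - p)) ≤ ‖b‖ * ‖π (z - p)‖ := real_inner_le_norm _ _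
  have c3 := hconst ‖b‖ ‖π (z - p)‖ _ (h.norm_sq_le (z - p))
  -- the noise
  have n1 : - inner ℝ e (π (p - t)) ≤ ‖e‖ * ‖π (p - t)‖ := by
    have := (abs_le.1 (abs_real_inner_le_norm e (π (p - t)))).1
    linarith
  have n2 : κ * ‖π (p - t)‖ ≤ ‖e‖ := by
    rcases (norm_nonneg (π (p - t))).eq_or_lt with h0 | h0
    · rw [← h0, mul_zero]; exact norm_nonneg _
    · have := h.norm_sq_le (p - t)
      refine le_of_mul_le_mul_right ?_ h0
      linarith
  have n3 : ‖e‖ * ‖π (p - t)‖ ≤ 1 / κ * ‖e‖ ^ 2 := by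
    have : ‖π (p - t)‖ ≤ ‖e‖ / κ := by rw [le_div_iff₀ hκ]; linarith
    calc ‖e‖ * ‖π (p - t)‖ ≤ ‖e‖ * (‖e‖ / κ) := mul_le_mul_of_nonneg_left this (norm_nonneg _)
      _ = _ := by ring
  have q1 : inner ℝ (S (z - t)) (z - t) ≤
      2 * inner ℝ (S (z - p)) (z - p) + 2 * inner ℝ (S (p - t)) (p - t) := by
    have h1 := h.inner_add (z - p) (p - t)
    have h2 := h.inner_self_nonneg ((z - p) + (-1 : ℝ) • (p - t))
    rw [h.inner_add_smul] at h2
    rw [sub_add_sub_cancel] at h1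
    linarith
  rw [inner_add_left] at m1
  have q2 : c * inner ℝ (S (z - t)) (z - t) ≤
      c * (2 * inner ℝ (S (z - p)) (z - p) + 2 * (1 / κ * ‖e‖ ^ 2)) :=
    mul_le_mul_of_nonneg_left (by linarith) hc.le
  have hbb : 0 ≤ c * ‖b‖ ^ 2 := by positivity
  have eC : (2 / κ + c / κ) * ‖e‖ ^ 2 = 2 * (1 / κ * ‖e‖ ^ 2) + c * (1 / κ * ‖e‖ ^ 2) := by ring
  rw [eC]
  linarith

/-- Weak cluster points of asymptotically exact iterates are zeros. -/
theorem mem_of_cluster (h : IsSplitting S π A B R κ β) {x z : ℕ → K} {x' x₀ : K}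
    {U : Ultrafilter ℕ} (hU : (U : Filter ℕ) ≤ atTop) {C : ℝ} (hC : ∀ n, ‖x n‖ ≤ C)
    (hz : Tendsto (fun n => z n - x n) atTop (𝓝 0))
    (ht : Tendsto (fun n => z n - R (S (z n) - π.adjoint (B (π (z n))))) atTop (𝓝 0))
    (hb : Tendsto (fun n => B (π (z n))) atTop (𝓝 (B (π x'))))
    (hx : WeakTendsto x U x₀) :
    -(π.adjoint (B (π x₀))) ∈ A x₀ ∧ B (π x₀) = B (π x') := by
  have hzb : ∃ C, ∀ n, ‖z n - x n‖ ≤ C := by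
    obtain ⟨C, hC⟩ := hz.norm.bddAbove_range
    exact ⟨C, fun n => hC ⟨n, rfl⟩⟩
  obtain ⟨C₁, hC₁⟩ := hzb
  have htb : ∃ C, ∀ n, ‖z n - R (S (z n) - π.adjoint (B (π (z n))))‖ ≤ C := by
    obtain ⟨C, hC⟩ := ht.norm.bddAbove_range
    exact ⟨C, fun n => hC ⟨n, rfl⟩⟩
  obtain ⟨C₂, hC₂⟩ := htb
  have hzw : WeakTendsto z U x₀ := by
    have := hx.add_of_tendsto_zero (hz.mono_left hU)
    simpa using this
  have hzn : ∀ n, ‖z n‖ ≤ C + C₁ := fun n => by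
    have := norm_add_le (x n) (z n - x n)
    rw [add_sub_cancel] at this
    linarith [hC n, hC₁ n]
  -- Cocoercivity between `z n` and `x₀` is passed to the limit: the gradients converge strongly and
  -- the points weakly, so the pairing tends to 0.
  have hBx : B (π x₀) = B (π x') := by
    have h1 : Tendsto (fun n => β * ‖B (π (z n)) - B (π x₀)‖ ^ 2) U
        (𝓝 (β * ‖B (π x') - B (π x₀)‖ ^ 2)) :=
      (((hb.mono_left hU).sub_const _).norm.pow 2).const_mul β
    have h2 : Tendsto (fun n => inner ℝ (B (π (z n)) - B (π x₀)) (π (z n) - π x₀)) U (𝓝 0) := by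
      have h3 := (hzw.map π).inner_of_tendsto ((hb.mono_left hU).sub_const (B (π x₀)))
        (C := ‖π‖ * (C + C₁)) (fun n => (π.le_opNorm _).trans
          (mul_le_mul_of_nonneg_left (hzn n) (norm_nonneg _)))
      have h4 := h3.sub (((hb.mono_left hU).sub_const (B (π x₀))).inner
        (tendsto_const_nhds (x := π x₀)))
      rw [sub_self] at h4
      refine h4.congr fun n => ?_
      rw [inner_sub_right]
    have h5 := le_of_tendsto_of_tendsto' h1 h2 fun n => h.cocoercive _ _
    have h6 : ‖B (π x') - B (π x₀)‖ ^ 2 = 0 := by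
      have := h.beta_pos
      refine le_antisymm ?_ (sq_nonneg _)
      by_contra! h7
      nlinarith
    exact (sub_eq_zero.1 (norm_eq_zero.1 (pow_eq_zero_iff two_ne_zero |>.1 h6))).symm
  refine ⟨?_, hBx⟩
  set t : ℕ → K := fun n => R (S (z n) - π.adjoint (B (π (z n)))) with ht_def
  have htw : WeakTendsto t U x₀ := by
    have h1 : Tendsto (fun n => -(z n - t n)) U (𝓝 0) := by simpa using (ht.mono_left hU).neg
    have := hzw.add_of_tendsto_zero h1
    simpa using this
  have htn : ∀ n, ‖t n‖ ≤ C + C₁ + C₂ := fun n => by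
    have := norm_sub_le (z n) (z n - t n)
    rw [sub_sub_cancel] at this
    linarith [hzn n, hC₂ n]
  refine h.mem_of_weakTendsto U t (fun n => S (z n - t n) - π.adjoint (B (π (z n)))) x₀ _ _ htw htn
    ?_ fun n => ?_
  · have h1 : Tendsto (fun n => S (z n - t n)) U (𝓝 0) := by
      have := (S.continuous.tendsto 0).comp (ht.mono_left hU)
      rwa [map_zero] at this
    have h2 := h1.sub ((π.adjoint.continuous.tendsto _).comp (hb.mono_left hU))
    rw [zero_sub] at h2
    rw [hBx]
    exact h2
  · have := h.resolvent (S (z n) - π.adjoint (B (π (z n))))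
    have e : S (z n - t n) - π.adjoint (B (π (z n))) =
        S (z n) - π.adjoint (B (π (z n))) - S (t n) := by rw [map_sub]; abel
    rw [e]
    exact this

end IsSplitting

end Splitting

/-! ### The inertial stochastic iteration and its almost sure weak convergence. -/

section StochasticSplitting

theorem memLp_comp_of_lipschitz {K H Ω : Type*} [NormedAddCommGroup K] [NormedAddCommGroup H]
    {m0 : MeasurableSpace Ω} {P : Measure Ω} [IsFiniteMeasure P] {f : Ω → K} (hf : MemLp f 2 P) {g : K → H} {L : NNReal}
    (hg : LipschitzWith L g) : MemLp (fun ω => g (f ω)) 2 P := by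
  have h1 : LipschitzWith L fun x => g x - g 0 := by
    refine LipschitzWith.of_dist_le_mul fun x y => ?_
    rw [dist_sub_right]
    exact hg.dist_le_mul x y
  have h2 := (h1.comp_memLp (sub_self _) hf).add (memLp_const (g 0))
  refine h2.congr_norm (hg.continuous.comp_aestronglyMeasurable hf.1) (ae_of_all _ fun ω => ?_)
  simp

variable {K H : Type*} [NormedAddCommGroup K] [InnerProductSpace ℝ K]
  [NormedAddCommGroup H] [InnerProductSpace ℝ H]
  {Ω : Type*} {m0 : MeasurableSpace Ω} {P : Measure Ω}

theorem MemLp.integrable_real_inner {f g : Ω → H} (hf : MemLp f 2 P) (hg : MemLp g 2 P) :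
    Integrable (fun ω => inner ℝ (f ω) (g ω)) P := by
  have h1 : Integrable (fun ω => ‖f ω‖ ^ 2 + ‖g ω‖ ^ 2) P :=
    (hf.integrable_norm_pow two_ne_zero).add (hg.integrable_norm_pow two_ne_zero)
  refine h1.mono' (hf.1.inner hg.1) (ae_of_all _ fun ω => ?_)
  refine (norm_inner_le_norm _ _).trans ?_
  nlinarith [sq_nonneg (‖f ω‖ - ‖g ω‖), sq_nonneg (‖f ω‖ + ‖g ω‖)]

theorem memLp_extrapolate {α : ℕ → ℝ} {x : ℕ → Ω → K} (hx : ∀ n, MemLp (x n) 2 P) (n : ℕ) :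
    MemLp (fun ω => extrapolate α (fun i => x i ω) n) 2 P :=
  (hx n).add (((hx n).sub (hx (n - 1))).const_smul (α n))

variable [CompleteSpace K] [CompleteSpace H]
  {S : K →L[ℝ] K} {π : K →L[ℝ] H} {A : K → Set K} {B : H → H} {R : K → K} {κ β : ℝ}
  {ℱ : Filtration ℕ m0} {α : ℕ → ℝ} {x : ℕ → Ω → K} {a : ℕ → Ω → H}

/-- The inertial stochastic forward-backward iteration `xₙ₊₁ = R (S zₙ - π† aₙ)` with unbiased
gradient estimates. -/
structure IsStochasticIteration (P : Measure Ω) (S : K →L[ℝ] K) (π : K →L[ℝ] H) (B : H → H)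
    (R : K → K) (ℱ : Filtration ℕ m0) (α : ℕ → ℝ) (x : ℕ → Ω → K) (a : ℕ → Ω → H) : Prop where
  adapted : ∀ n, StronglyMeasurable[ℱ n] (x n)
  memLp_zero : MemLp (x 0) 2 P
  memLp_noise : ∀ n, MemLp (a n) 2 P
  step : ∀ n ω, x (n + 1) ω =
    R (S (extrapolate α (fun i => x i ω) n) - π.adjoint (a n ω))
  unbiased : ∀ n, P[a n | ℱ n] =ᵐ[P] fun ω => B (π (extrapolate α (fun i => x i ω) n))
  summable_variance : ∀ᵐ ω ∂P, Summable fun n =>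
    (P[fun ω' => ‖a n ω' - B (π (extrapolate α (fun i => x i ω') n))‖ ^ 2 | ℱ n]) ω
  bounded_increments : ∀ᵐ ω ∂P, BddAbove (Set.range fun n => ‖x n ω - x (n - 1) ω‖)
  relaxation_nonneg : ∀ n, 0 ≤ α n
  relaxation_le_one : ∀ n, α n ≤ 1
  summable_relaxation : Summable α

namespace IsStochasticIteration

theorem stronglyMeasurable_extrapolate (h : IsStochasticIteration P S π B R ℱ α x a) (n : ℕ) :
    StronglyMeasurable[ℱ n] fun ω => extrapolate α (fun i => x i ω) n :=
  (h.adapted n).add (((h.adapted n).sub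
    ((h.adapted (n - 1)).mono (ℱ.mono (Nat.sub_le n 1)))).const_smul (α n))

theorem tendsto_extrapolate_sub (h : IsStochasticIteration P S π B R ℱ α x a) {ω : Ω}
    (hω : BddAbove (Set.range fun n => ‖x n ω - x (n - 1) ω‖)) :
    Tendsto (fun n => extrapolate α (fun i => x i ω) n - x n ω) atTop (𝓝 0) := by
  obtain ⟨C, hC⟩ := hω
  have h1 : Tendsto (fun n => α n * C) atTop (𝓝 0) := by
    simpa using h.summable_relaxation.tendsto_atTop_zero.mul_const C
  refine squeeze_zero_norm (fun n => ?_) h1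
  rw [extrapolate, add_sub_cancel_left, norm_smul, Real.norm_of_nonneg (h.relaxation_nonneg n)]
  exact mul_le_mul_of_nonneg_left (hC ⟨n, rfl⟩) (h.relaxation_nonneg n)

variable [IsProbabilityMeasure P]

theorem memLp (h : IsStochasticIteration P S π B R ℱ α x a) (hs : IsSplitting S π A B R κ β)
    (n : ℕ) : MemLp (x n) 2 P := by
  obtain ⟨L, hL⟩ := hs.exists_lipschitz_R
  induction n using Nat.strong_induction_on with
  | _ n ih =>
    cases n with
    | zero => exact h.memLp_zero
    | succ n =>
      have h1 : MemLp (fun ω => extrapolate α (fun i => x i ω) n) 2 P :=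
        (ih n (by omega)).add (((ih n (by omega)).sub (ih (n - 1) (by omega))).const_smul (α n))
      have h2 : MemLp (fun ω => S (extrapolate α (fun i => x i ω) n) - π.adjoint (a n ω)) 2 P :=
        (S.comp_memLp' h1).sub (π.adjoint.comp_memLp' (h.memLp_noise n))
      have h3 := memLp_comp_of_lipschitz h2 hL
      exact h3.congr_norm (((h.adapted (n + 1)).mono (ℱ.le _)).aestronglyMeasurable)
        (ae_of_all _ fun ω => by rw [h.step n ω])

/-- Stochastic quasi-Fejér monotonicity with respect to a zero `x'`. -/
theorem ae_tendsto_and_summable (h : IsStochasticIteration P S π B R ℱ α x a)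
    (hs : IsSplitting S π A B R κ β) {x' : K} (hx' : -(π.adjoint (B (π x'))) ∈ A x') :
    ∀ᵐ ω ∂P, (∃ l, Tendsto (fun n => inner ℝ (S (x n ω - x')) (x n ω - x')) atTop (𝓝 l)) ∧
      Summable fun n =>
        inner ℝ (S (extrapolate α (fun i => x i ω) n -
            R (S (extrapolate α (fun i => x i ω) n) -
              π.adjoint (B (π (extrapolate α (fun i => x i ω) n))))))
          (extrapolate α (fun i => x i ω) n -
            R (S (extrapolate α (fun i => x i ω) n) -
              π.adjoint (B (π (extrapolate α (fun i => x i ω) n))))) +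
        ‖B (π (extrapolate α (fun i => x i ω) n)) - B (π x')‖ ^ 2 := by
  obtain ⟨c, C, hc, hC, hstep⟩ := hs.exists_step_inequality
  obtain ⟨L, hL⟩ := hs.exists_lipschitz_R
  have hB := hs.lipschitz_B
  have hxL := h.memLp hs
  have hxm : ∀ n, StronglyMeasurable[ℱ n] (x n) := h.adapted
  have hxm' : ∀ n, StronglyMeasurable[ℱ n] (x (n - 1)) := fun n =>
    (h.adapted (n - 1)).mono (ℱ.mono (Nat.sub_le n 1))
  set z : ℕ → Ω → K := fun n ω => extrapolate α (fun i => x i ω) n with hz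
  have hzm : ∀ n, StronglyMeasurable[ℱ n] (z n) := h.stronglyMeasurable_extrapolate
  have hzL : ∀ n, MemLp (z n) 2 P := memLp_extrapolate hxL
  set g : ℕ → Ω → H := fun n ω => B (π (z n ω)) with hg
  have hgm : ∀ n, StronglyMeasurable[ℱ n] (g n) := fun n =>
    (hB.continuous.comp π.continuous).comp_stronglyMeasurable (hzm n)
  have hgL : ∀ n, MemLp (g n) 2 P := fun n =>
    memLp_comp_of_lipschitz (π.comp_memLp' (hzL n)) hB
  set t : ℕ → Ω → K := fun n ω => R (S (z n ω) - π.adjoint (g n ω)) with ht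
  have htm : ∀ n, StronglyMeasurable[ℱ n] (t n) := fun n =>
    hL.continuous.comp_stronglyMeasurable
      ((S.continuous.comp_stronglyMeasurable (hzm n)).sub
        (π.adjoint.continuous.comp_stronglyMeasurable (hgm n)))
  have htL : ∀ n, MemLp (t n) 2 P := fun n =>
    memLp_comp_of_lipschitz ((S.comp_memLp' (hzL n)).sub (π.adjoint.comp_memLp' (hgL n))) hL
  -- quadratic functions of the processes
  have quadm : ∀ {m : MeasurableSpace Ω} {y : Ω → K}, StronglyMeasurable[m] y →
      StronglyMeasurable[m] fun ω => inner ℝ (S (y ω)) (y ω) := fun hy =>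
    (S.continuous.comp_stronglyMeasurable hy).inner hy
  have quadi : ∀ {y : Ω → K}, MemLp y 2 P → Integrable (fun ω => inner ℝ (S (y ω)) (y ω)) P :=
    fun hy => MemLp.integrable_real_inner (S.comp_memLp' hy) hy
  set Y : ℕ → Ω → ℝ := fun n ω => inner ℝ (S (x n ω - x')) (x n ω - x') with hY
  set X : ℕ → Ω → ℝ := fun n ω => inner ℝ (S (z n ω - t n ω)) (z n ω - t n ω) +
    ‖g n ω - B (π x')‖ ^ 2 with hX
  set e : ℕ → Ω → H := fun n ω => a n ω - g n ω with he
  set v : ℕ → Ω → ℝ := fun n => P[fun ω => ‖e n ω‖ ^ 2 | ℱ n] with hv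
  set q : ℕ → Ω → ℝ := fun n ω =>
    inner ℝ (S (x n ω - x (n - 1) ω)) (x n ω - x (n - 1) ω) with hq
  -- The conditional variance is nonnegative only almost surely, hence the truncation at 0: the
  -- perturbations must be nonnegative everywhere.
  set η : ℕ → Ω → ℝ := fun n ω => (α n + α n ^ 2) * q n ω + C * max (v n ω) 0 with hη
  have heL : ∀ n, MemLp (e n) 2 P := fun n => (h.memLp_noise n).sub (hgL n)
  have hXm : ∀ n, StronglyMeasurable[ℱ n] (X n) := fun n =>
    (quadm ((hzm n).sub (htm n))).add (((hgm n).sub stronglyMeasurable_const).norm.pow 2)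
  have hXi : ∀ n, Integrable (X n) P := fun n =>
    (quadi ((hzL n).sub (htL n))).add
      (((hgL n).sub (memLp_const _)).integrable_norm_pow two_ne_zero)
  have hX0 : ∀ n ω, 0 ≤ X n ω := fun n ω =>
    add_nonneg (hs.inner_self_nonneg _) (sq_nonneg _)
  have hY0 : ∀ n ω, 0 ≤ Y n ω := fun n ω => hs.inner_self_nonneg _
  have hYi : ∀ n, Integrable (Y n) P := fun n => quadi ((hxL n).sub (memLp_const x'))
  have hYm : ∀ n, StronglyMeasurable[ℱ n] (Y n) := fun n =>
    quadm ((hxm n).sub stronglyMeasurable_const)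
  have hα2 : ∀ n, 0 ≤ α n + α n ^ 2 := fun n =>
    add_nonneg (h.relaxation_nonneg n) (sq_nonneg _)
  have hvpos : ∀ᵐ ω ∂P, ∀ n, 0 ≤ v n ω := ae_all_iff.2 fun n =>
    condExp_nonneg (ae_of_all _ fun ω => sq_nonneg _)
  have hvm : ∀ n, StronglyMeasurable[ℱ n] (v n) := fun n => stronglyMeasurable_condExp
  have hηm : ∀ n, StronglyMeasurable[ℱ n] (η n) := fun n =>
    ((quadm ((hxm n).sub (hxm' n))).const_mul _).add
      (((continuous_id.max (continuous_const (y := (0 : ℝ)))).comp_stronglyMeasurable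
        (hvm n)).const_mul C)
  have hηi : ∀ n, Integrable (η n) P := fun n =>
    ((quadi ((hxL n).sub (hxL (n - 1)))).const_mul _).add
      ((integrable_condExp.sup (integrable_const 0)).const_mul C)
  have hη0 : ∀ n ω, 0 ≤ η n ω := fun n ω =>
    add_nonneg (mul_nonneg (hα2 n) (hs.inner_self_nonneg _)) (mul_nonneg hC (le_max_right _ _))
  have hηs : ∀ᵐ ω ∂P, Summable fun n => η n ω := by
    filter_upwards [hvpos, h.summable_variance, h.bounded_increments] with ω h1 h2 h3
    refine Summable.add ?_ ?_
    · obtain ⟨D, hD⟩ := h3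
      refine Summable.of_nonneg_of_le (fun n => mul_nonneg (hα2 n) (hs.inner_self_nonneg _))
        (fun n => ?_) (h.summable_relaxation.mul_left (2 * (‖S‖ * D ^ 2)))
      have h4 : ‖x n ω - x (n - 1) ω‖ ≤ D := hD ⟨n, rfl⟩
      have h5 : q n ω ≤ ‖S‖ * D ^ 2 := by
        calc q n ω ≤ ‖S (x n ω - x (n - 1) ω)‖ * ‖x n ω - x (n - 1) ω‖ := real_inner_le_norm _ _
          _ ≤ ‖S‖ * ‖x n ω - x (n - 1) ω‖ * ‖x n ω - x (n - 1) ω‖ :=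
            mul_le_mul_of_nonneg_right (S.le_opNorm _) (norm_nonneg _)
          _ = ‖S‖ * ‖x n ω - x (n - 1) ω‖ ^ 2 := by ring
          _ ≤ _ := by gcongr
      have h6 : α n + α n ^ 2 ≤ 2 * α n := by
        nlinarith [h.relaxation_nonneg n, h.relaxation_le_one n]
      calc (α n + α n ^ 2) * q n ω ≤ (2 * α n) * (‖S‖ * D ^ 2) :=
            mul_le_mul h6 h5 (hs.inner_self_nonneg _) (by linarith [h.relaxation_nonneg n])
        _ = _ := by ring
    · refine (h2.mul_left C).congr fun n => ?_
      rw [max_eq_left (h1 n)]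
  have hmain := ae_tendsto_and_summable_of_condExp_le (P := P) (ℱ := ℱ) (Y := Y)
    (X := fun n ω => c * X n ω) (η := η) h.relaxation_nonneg h.summable_relaxation
    hYm hYi hY0 (fun n => (hXm n).const_mul c) (fun n => (hXi n).const_mul c)
    (fun n ω => mul_nonneg hc.le (hX0 n ω)) hηm hηi hη0 hηs ?_
  · filter_upwards [hmain] with ω hω
    refine ⟨hω.1, ?_⟩
    exact (summable_mul_left_iff hc.ne').1 hω.2
  intro n
  set G : Ω → ℝ := fun ω => inner ℝ (S (z n ω - x')) (z n ω - x') - c * X n ω with hG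
  set w : Ω → H := fun ω => π (t n ω - x') with hw
  have hwm : StronglyMeasurable[ℱ n] w :=
    π.continuous.comp_stronglyMeasurable ((htm n).sub stronglyMeasurable_const)
  have hwL : MemLp w 2 P := π.comp_memLp' ((htL n).sub (memLp_const x'))
  have hGm : StronglyMeasurable[ℱ n] G :=
    (quadm ((hzm n).sub stronglyMeasurable_const)).sub ((hXm n).const_mul c)
  have hGi : Integrable G P := (quadi ((hzL n).sub (memLp_const x'))).sub ((hXi n).const_mul c)
  have hewi : Integrable (fun ω => inner ℝ (e n ω) (w ω)) P :=
    MemLp.integrable_real_inner (heL n) hwL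
  have he2i : Integrable (fun ω => ‖e n ω‖ ^ 2) P := (heL n).integrable_norm_pow two_ne_zero
  -- The factor `w` is built from the exact step, so it is known at time n and can be pulled out;
  -- the conditional mean of `e n` vanishes by unbiasedness.
  have hcross : P[fun ω => inner ℝ (e n ω) (w ω) | ℱ n] =ᵐ[P] 0 := by
    have h1 := condExp_bilin_of_stronglyMeasurable_right (μ := P) (m := ℱ n) (innerSL ℝ (E := H))
      hwm hewi ((heL n).integrable one_le_two)
    have h2 : P[e n | ℱ n] =ᵐ[P] P[a n | ℱ n] - P[g n | ℱ n] :=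
      condExp_sub ((h.memLp_noise n).integrable one_le_two) ((hgL n).integrable one_le_two) _
    rw [condExp_of_stronglyMeasurable (ℱ.le n) (hgm n) ((hgL n).integrable one_le_two)] at h2
    refine h1.trans ?_
    filter_upwards [h2, h.unbiased n] with ω h3 h4
    rw [h3, Pi.sub_apply, h4]
    simp [hg, hz]
  have hle : Y (n + 1) ≤ᵐ[P]
      G + ((-2 : ℝ) • (fun ω => inner ℝ (e n ω) (w ω)) + C • fun ω => ‖e n ω‖ ^ 2) := by
    refine ae_of_all _ fun ω => ?_
    have h1 := hstep (z n ω) x' (a n ω) hx'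
    simp only [hY, hG, hX, hw, he, hg, ht, Pi.add_apply, Pi.smul_apply, smul_eq_mul]
    rw [h.step n ω]
    linarith
  have hri : Integrable ((-2 : ℝ) • (fun ω => inner ℝ (e n ω) (w ω)) +
      C • fun ω => ‖e n ω‖ ^ 2) P := (hewi.smul _).add (he2i.smul _)
  have hmono := condExp_mono (m := ℱ n) (hYi (n + 1)) (hGi.add hri) hle
  have e1 := condExp_add hGi hri (ℱ n)
  rw [condExp_of_stronglyMeasurable (ℱ.le n) hGm hGi] at e1
  have e2 := condExp_add (hewi.smul (-2 : ℝ)) (he2i.smul C) (ℱ n)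
  have e3 := condExp_smul (μ := P) (-2 : ℝ) (fun ω => inner ℝ (e n ω) (w ω)) (ℱ n)
  have e4 := condExp_smul (μ := P) C (fun ω => ‖e n ω‖ ^ 2) (ℱ n)
  filter_upwards [hmono, e1, e2, e3, e4, hcross, hvpos] with ω k0 k1 k2 k3 k4 k5 k6
  rw [k1, Pi.add_apply, k2, Pi.add_apply, k3, k4, Pi.smul_apply, Pi.smul_apply, k5] at k0
  have k7 := hs.le_of_relaxation (x n ω - x') (x n ω - x (n - 1) ω) (h.relaxation_nonneg n)
  have k8 : x n ω - x' + α n • (x n ω - x (n - 1) ω) = z n ω - x' := by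
    simp only [hz, extrapolate]; abel
  rw [k8] at k7
  simp only [Pi.zero_apply, smul_eq_mul, mul_zero, zero_add] at k0
  simp only [hη, hq, hY, max_eq_left (k6 n)]
  simp only [hG] at k0
  linarith

/-- Almost sure weak convergence of the stochastic iteration to a random zero. -/
theorem exists_weak_limit (h : IsStochasticIteration P S π B R ℱ α x a)
    (hs : IsSplitting S π A B R κ β) (hzero : ∃ x', -(π.adjoint (B (π x'))) ∈ A x') :
    ∃ y : Ω → K, StronglyMeasurable y ∧ ∀ᵐ ω ∂P,
      WeakTendsto (fun n => x n ω) atTop (y ω) ∧ -(π.adjoint (B (π (y ω)))) ∈ A (y ω) ∧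
      (∃ C, ∀ n, ‖x n ω‖ ≤ C) ∧
      Tendsto (fun n => extrapolate α (fun i => x i ω) n - x n ω) atTop (𝓝 0) ∧
      Tendsto (fun n => B (π (extrapolate α (fun i => x i ω) n))) atTop (𝓝 (B (π (y ω)))) := by
  obtain ⟨x', hx'⟩ := hzero
  obtain ⟨c, hc, hS⟩ := hs.coercive
  have hxm : ∀ n, StronglyMeasurable (x n) := fun n => (h.adapted n).mono (ℱ.le n)
  -- a closed separable subspace containing all iterates
  set T : Submodule ℝ K := (Submodule.span ℝ (⋃ n, Set.range (x n))).topologicalClosure with hT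
  have hTclosed : IsClosed (T : Set K) := Submodule.isClosed_topologicalClosure _
  have hxT : ∀ n ω, x n ω ∈ T := fun n ω =>
    Submodule.le_topologicalClosure _ (Submodule.subset_span (Set.mem_iUnion.2 ⟨n, ω, rfl⟩))
  have hTsep : TopologicalSpace.IsSeparable (T : Set K) := by
    rw [hT, Submodule.topologicalClosure_coe]
    exact ((TopologicalSpace.IsSeparable.iUnion fun n => (hxm n).isSeparable_range).span).closure
  -- The exceptional null set of the quasi-Fejér property depends on the zero. Only zeros in the
  -- separable space `T` can be weak limits of the iterates, and a countable dense subset of them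
  -- leaves a single null set.
  set Z : Set K := {y | -(π.adjoint (B (π y))) ∈ A y} ∩ T with hZ
  obtain ⟨D, hDZ, hDc, hZD⟩ := (hTsep.mono (Set.inter_subset_right :
    Z ⊆ (T : Set K))).exists_countable_dense_subset
  have hD : ∀ᵐ ω ∂P, ∀ d ∈ D,
      ∃ l, Tendsto (fun n => inner ℝ (S (x n ω - d)) (x n ω - d)) atTop (𝓝 l) :=
    (ae_ball_iff hDc).2 fun d hd => by
      filter_upwards [h.ae_tendsto_and_summable hs (hDZ hd).1] with ω hω using hω.1
  -- the conclusion holds with some limit, almost surely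
  have key : ∀ᵐ ω ∂P, ∃ y, WeakTendsto (fun n => x n ω) atTop y ∧
      -(π.adjoint (B (π y))) ∈ A y ∧ (∃ C, ∀ n, ‖x n ω‖ ≤ C) ∧
      Tendsto (fun n => extrapolate α (fun i => x i ω) n - x n ω) atTop (𝓝 0) ∧
      Tendsto (fun n => B (π (extrapolate α (fun i => x i ω) n))) atTop (𝓝 (B (π y))) := by
    filter_upwards [hD, h.ae_tendsto_and_summable hs hx', h.bounded_increments]
      with ω hD hω hinc
    obtain ⟨⟨l, hl⟩, hsum⟩ := hω
    have hzx := h.tendsto_extrapolate_sub hinc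
    set z : ℕ → K := fun n => extrapolate α (fun i => x i ω) n with hz
    have hbdd : ∃ C, ∀ n, ‖x n ω‖ ≤ C := by
      obtain ⟨M, hM⟩ := hl.bddAbove_range
      refine ⟨‖x'‖ + (M / c + 1), fun n => ?_⟩
      have h1 : inner ℝ (S (x n ω - x')) (x n ω - x') ≤ M := hM ⟨n, rfl⟩
      have h2 : ‖x n ω - x'‖ ^ 2 ≤ M / c := by
        rw [le_div_iff₀ hc]; linarith [hS (x n ω - x')]
      have h3 : ‖x n ω‖ ≤ ‖x'‖ + ‖x n ω - x'‖ := by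
        simpa using norm_add_le x' (x n ω - x')
      nlinarith [sq_nonneg (‖x n ω - x'‖ - 1), norm_nonneg (x n ω - x')]
    obtain ⟨C, hC⟩ := hbdd
    have hX := hsum.tendsto_atTop_zero
    have ht : Tendsto (fun n => z n - R (S (z n) - π.adjoint (B (π (z n))))) atTop (𝓝 0) := by
      rw [tendsto_zero_iff_norm_tendsto_zero]
      have h1 : Tendsto (fun n => ‖z n - R (S (z n) - π.adjoint (B (π (z n))))‖ ^ 2) atTop
          (𝓝 0) := by
        have h2 := hX.const_mul c⁻¹
        rw [mul_zero] at h2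
        refine squeeze_zero (fun n => sq_nonneg _) (fun n => ?_) h2
        rw [inv_mul_eq_div, le_div_iff₀ hc]
        have h3 := hS (z n - R (S (z n) - π.adjoint (B (π (z n)))))
        have h4 := sq_nonneg ‖B (π (z n)) - B (π x')‖
        simp only [hz] at h3 h4 ⊢
        linarith
      have h5 := (Real.continuous_sqrt.tendsto 0).comp h1
      rw [Real.sqrt_zero] at h5
      exact h5.congr fun n => Real.sqrt_sq (norm_nonneg _)
    have hb : Tendsto (fun n => B (π (z n))) atTop (𝓝 (B (π x'))) := by
      rw [tendsto_iff_norm_sub_tendsto_zero]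
      have h1 : Tendsto (fun n => ‖B (π (z n)) - B (π x')‖ ^ 2) atTop (𝓝 0) := by
        refine squeeze_zero (fun n => sq_nonneg _) (fun n => ?_) hX
        exact le_add_of_nonneg_left (hs.inner_self_nonneg _)
      have h5 := (Real.continuous_sqrt.tendsto 0).comp h1
      rw [Real.sqrt_zero] at h5
      exact h5.congr fun n => Real.sqrt_sq (norm_nonneg _)
    have hcl : ∀ (U : Ultrafilter ℕ), (U : Filter ℕ) ≤ atTop → ∀ y,
        WeakTendsto (fun n => x n ω) U y → y ∈ Z ∧ B (π y) = B (π x') := by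
      intro U hU y hy
      have h1 := hs.mem_of_cluster hU hC hzx ht hb hy
      exact ⟨⟨h1.1, mem_of_weakTendsto hTclosed hy fun n => hxT n ω⟩, h1.2⟩
    -- weak limits along ultrafilters agree
    have huniq : ∀ (U U' : Ultrafilter ℕ), (U : Filter ℕ) ≤ atTop → (U' : Filter ℕ) ≤ atTop →
        ∀ y y', WeakTendsto (fun n => x n ω) U y → WeakTendsto (fun n => x n ω) U' y' →
        y = y' := by
      intro U U' hU hU' y y' hy hy'
      have hdiff : ∀ d ∈ D, ∀ d' ∈ D, inner ℝ (S (d - d')) (y - y') = 0 := by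
        intro d hd d' hd'
        obtain ⟨l, hl⟩ := hD d hd
        obtain ⟨l', hl'⟩ := hD d' hd'
        -- Opial: the difference of the squared S-distances to `d` and `d'` is affine in the iterate
        -- with linear part ⟪S(d − d'), ·⟫, up to a factor, so this pairing converges along the full
        -- sequence.
        have h1 : Tendsto (fun n => inner ℝ (S (d - d')) (x n ω)) atTop
            (𝓝 ((1 / 2) * (l' - l + inner ℝ (S d) d - inner ℝ (S d') d'))) := by
          refine (((hl'.sub hl).add_const _).sub_const _ |>.const_mul (1 / 2)).congr fun n => ?_
          simp only [map_sub, inner_sub_left, inner_sub_right]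
          rw [hs.symm (x n ω) d, hs.symm (x n ω) d', real_inner_comm (S d) (x n ω),
            real_inner_comm (S d') (x n ω)]
          ring
        have h2 := tendsto_nhds_unique (hy _) (h1.mono_left hU)
        have h3 := tendsto_nhds_unique (hy' _) (h1.mono_left hU')
        rw [inner_sub_right, h2, h3, sub_self]
      have hclosed : ∀ d d', d ∈ closure D → d' ∈ closure D →
          inner ℝ (S (d - d')) (y - y') = 0 := by
        intro d d' hd hd'
        have hcont : Continuous fun p : K × K => inner ℝ (S (p.1 - p.2)) (y - y') := by fun_prop
        have hmem : (d, d') ∈ closure (D ×ˢ D) := by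
          rw [closure_prod_eq]; exact ⟨hd, hd'⟩
        have := closure_minimal (t := {p : K × K | inner ℝ (S (p.1 - p.2)) (y - y') = 0})
          (fun p hp => hdiff p.1 hp.1 p.2 hp.2) (isClosed_eq hcont continuous_const) hmem
        exact this
      have h0 := hclosed y y' (hZD (hcl U hU y hy).1) (hZD (hcl U' hU' y' hy').1)
      have h1 := hS (y - y')
      rw [h0] at h1
      have h2 : ‖y - y'‖ ^ 2 = 0 := by
        refine le_antisymm ?_ (sq_nonneg _)
        by_contra! h4
        nlinarith
      exact sub_eq_zero.1 (norm_eq_zero.1 (pow_eq_zero_iff two_ne_zero |>.1 h2))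
    -- Every ultrafilter finer than `atTop` yields a weak limit, and all of them coincide with this
    -- one, so the whole sequence converges weakly.
    obtain ⟨y, hy⟩ := exists_weakTendsto_ultrafilter hC (Ultrafilter.of atTop)
    have hof : (Ultrafilter.of (atTop : Filter ℕ) : Filter ℕ) ≤ atTop := Ultrafilter.of_le atTop
    have hyZ := hcl _ hof y hy
    refine ⟨y, fun u => ?_, hyZ.1.1, ⟨C, hC⟩, hzx, hyZ.2 ▸ hb⟩
    rw [tendsto_iff_ultrafilter]
    intro U hU
    obtain ⟨y', hy'⟩ := exists_weakTendsto_ultrafilter hC U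
    rw [huniq _ U hof hU y y' hy hy']
    exact hy' u
  obtain ⟨y, hym, hy⟩ := exists_stronglyMeasurable_weak_limit hxm
    (key.mono fun ω ⟨y, hy, _⟩ => ⟨y, hy⟩)
  refine ⟨y, hym, ?_⟩
  filter_upwards [key, hy] with ω ⟨y', hy', hrest⟩ h2
  have : y' = y ω := ext_inner_left ℝ fun u => tendsto_nhds_unique (hy' u) (h2 u)
  rw [← this]
  exact ⟨hy', hrest⟩

end IsStochasticIteration

end StochasticSplitting

/-! ### Strongly positive operators: square roots, inverses and sharp bounds. -/

section Operators

variable {E : Type*} [NormedAddCommGroup E] [InnerProductSpace ℝ E] [CompleteSpace E]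
  {T : E →L[ℝ] E}

theorem StronglyPositive.inner_map_comm (hT : StronglyPositive T) (x y : E) :
    inner ℝ (T x) y = inner ℝ x (T y) := by
  have h : T.adjoint = T := hT.1
  rw [← ContinuousLinearMap.adjoint_inner_right, h]

/-- A symmetric strict contraction `B` satisfies `(1 - A)² = 1 - B` for a symmetric strict
contraction `A`. -/
theorem exists_symmetric_sq_one_sub {B : E →L[ℝ] E}
    (hB : ∀ x y, inner ℝ (B x) y = inner ℝ x (B y)) {q : ℝ} (hBq : ‖B‖ ≤ q) (hq : q < 1) :
    ∃ A : E →L[ℝ] E, (∀ x y, inner ℝ (A x) y = inner ℝ x (A y)) ∧ ‖A‖ ≤ q ∧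
      (1 - A) * (1 - A) = 1 - B := by
  have hq0 : 0 ≤ q := (norm_nonneg _).trans hBq
  set s : Set (E →L[ℝ] E) := {A | (∀ x y, inner ℝ (A x) y = inner ℝ x (A y)) ∧ ‖A‖ ≤ q} with hs
  -- The equation (1 − A)² = 1 − B reads A = (B + A²)/2, a fixed point problem for a q-contraction
  -- of the closed set `s`.
  set f : (E →L[ℝ] E) → (E →L[ℝ] E) := fun A => (1 / 2 : ℝ) • (B + A * A) with hf
  have hclosed : IsClosed s := by
    have h1 : IsClosed {A : E →L[ℝ] E | ∀ x y, inner ℝ (A x) y = inner ℝ x (A y)} := by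
      simp only [Set.ofPred_forall]
      exact isClosed_iInter fun x => isClosed_iInter fun y =>
        isClosed_eq (by fun_prop) (by fun_prop)
    exact h1.inter (isClosed_le continuous_norm continuous_const)
  have hmaps : Set.MapsTo f s s := by
    rintro A ⟨hA, hAq⟩
    refine ⟨fun x y => ?_, ?_⟩
    · change inner ℝ ((1 / 2 : ℝ) • (B x + A (A x))) y = inner ℝ x ((1 / 2 : ℝ) • (B y + A (A y)))
      rw [real_inner_smul_left, real_inner_smul_right, inner_add_left, inner_add_right, hB, hA, hA]
    rw [hf, norm_smul, Real.norm_of_nonneg (by norm_num)]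
    have h1 : ‖B + A * A‖ ≤ q + q * q :=
      (norm_add_le _ _).trans (add_le_add hBq ((norm_mul_le _ _).trans
        (mul_le_mul hAq hAq (norm_nonneg _) hq0)))
    nlinarith
  have hcontr : ContractingWith ⟨q, hq0⟩ (hmaps.restrict f s s) := by
    refine ⟨hq, LipschitzWith.of_dist_le_mul ?_⟩
    rintro ⟨A, hA, hAq⟩ ⟨C, hC, hCq⟩
    change dist (f A) (f C) ≤ q * dist A C
    rw [dist_eq_norm, dist_eq_norm, hf, ← smul_sub, norm_smul, Real.norm_of_nonneg (by norm_num)]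
    have e : B + A * A - (B + C * C) = A * (A - C) + (A - C) * C := by noncomm_ring
    rw [e]
    have h1 : ‖A * (A - C) + (A - C) * C‖ ≤ q * ‖A - C‖ + ‖A - C‖ * q :=
      (norm_add_le _ _).trans (add_le_add
        ((norm_mul_le _ _).trans (mul_le_mul_of_nonneg_right hAq (norm_nonneg _)))
        ((norm_mul_le _ _).trans (mul_le_mul_of_nonneg_left hCq (norm_nonneg _))))
    linarith
  obtain ⟨A, hA, hfix, -⟩ := hcontr.exists_fixedPoint' hclosed.isComplete hmaps
    (x := 0) ⟨fun x y => by simp, by simpa using hq0⟩ (edist_ne_top _ _)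
  refine ⟨A, hA.1, hA.2, ?_⟩
  have h1 : (1 / 2 : ℝ) • (B + A * A) = A := hfix
  have h2 : B + A * A = A + A := by
    calc B + A * A = (2 : ℝ) • ((1 / 2 : ℝ) • (B + A * A)) := by
          rw [smul_smul]; norm_num
      _ = A + A := by rw [h1, two_smul]
  have h3 : B = A + A - A * A := by rw [← h2]; abel
  rw [h3]
  noncomm_ring

/-- After division by a large m, the operator is 1 minus a symmetric strict contraction, whose root
the fixed point argument supplies. Existence gives content to the choice made in `opSqrt`. -/
theorem StronglyPositive.exists_sqrt (hT : StronglyPositive T) :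
    ∃ S : E →L[ℝ] E, S.IsPositive ∧ S ∘L S = T := by
  have hsa := hT.inner_map_comm
  obtain ⟨-, c, hc, hTc⟩ := hT
  -- With ‖T‖² ≤ c m the square term ‖T x‖²/m² is at most (c/m)‖x‖², half of what the cross term
  -- gains; hence ‖x − T x/m‖² ≤ (1 − c/m)‖x‖².
  set m : ℝ := (‖T‖ ^ 2 + 1) / c with hm
  have hm0 : 0 < m := by positivity
  set B : E →L[ℝ] E := 1 - m⁻¹ • T with hB
  have hBsa : ∀ x y, inner ℝ (B x) y = inner ℝ x (B y) := fun x y => by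
    change inner ℝ (x - m⁻¹ • T x) y = inner ℝ x (y - m⁻¹ • T y)
    rw [inner_sub_left, inner_sub_right, real_inner_smul_left, real_inner_smul_right, hsa]
  have hBn : ‖B‖ ≤ √(1 - c / m) := by
    refine ContinuousLinearMap.opNorm_le_bound _ (Real.sqrt_nonneg _) fun x => ?_
    rw [← Real.sqrt_sq (norm_nonneg x), ← Real.sqrt_mul' _ (sq_nonneg _)]
    refine Real.le_sqrt_of_sq_le ?_
    have e : B x = x - m⁻¹ • T x := by simp [hB]
    rw [e, norm_sub_sq_real, norm_smul, inner_smul_right, Real.norm_of_nonneg (by positivity)]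
    have h1 := hTc x
    rw [real_inner_comm] at h1
    have h2 : ‖T x‖ ^ 2 ≤ ‖T‖ ^ 2 * ‖x‖ ^ 2 := by
      rw [← mul_pow]; exact pow_le_pow_left₀ (norm_nonneg _) (T.le_opNorm x) 2
    have h3 : (m⁻¹ * ‖T x‖) ^ 2 ≤ c / m * ‖x‖ ^ 2 := by
      have h4 : ‖T‖ ^ 2 ≤ c * m := by rw [hm]; field_simp; linarith
      calc (m⁻¹ * ‖T x‖) ^ 2 = m⁻¹ ^ 2 * ‖T x‖ ^ 2 := by ring
        _ ≤ m⁻¹ ^ 2 * (c * m * ‖x‖ ^ 2) := by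
          refine mul_le_mul_of_nonneg_left (h2.trans ?_) (by positivity)
          exact mul_le_mul_of_nonneg_right h4 (sq_nonneg _)
        _ = _ := by field_simp
    have h5 : m⁻¹ * (c * ‖x‖ ^ 2) ≤ m⁻¹ * inner ℝ x (T x) :=
      mul_le_mul_of_nonneg_left h1 (by positivity)
    have h6 : m⁻¹ * (c * ‖x‖ ^ 2) = c / m * ‖x‖ ^ 2 := by ring
    linarith
  have hq : √(1 - c / m) < 1 := by
    rw [Real.sqrt_lt' one_pos]
    have : 0 < c / m := by positivity
    linarith
  obtain ⟨A, hA, hAn, hAB⟩ := exists_symmetric_sq_one_sub hBsa hBn hq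
  refine ⟨√m • (1 - A), ⟨fun x y => ?_, fun x => ?_⟩, ?_⟩
  · change inner ℝ (√m • (x - A x)) y = inner ℝ x (√m • (y - A y))
    rw [real_inner_smul_left, real_inner_smul_right, inner_sub_left, inner_sub_right, hA]
  · have e : ContinuousLinearMap.reApplyInnerSelf (√m • (1 - A)) x =
        √m * (‖x‖ ^ 2 - inner ℝ (A x) x) := by
      change inner ℝ (√m • (x - A x)) x = _
      rw [real_inner_smul_left, inner_sub_left, real_inner_self_eq_norm_sq]
    change 0 ≤ ContinuousLinearMap.reApplyInnerSelf (√m • (1 - A)) x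
    rw [e]
    refine mul_nonneg (Real.sqrt_nonneg _) ?_
    have h1 : inner ℝ (A x) x ≤ ‖A‖ * ‖x‖ * ‖x‖ :=
      (real_inner_le_norm _ _).trans (mul_le_mul_of_nonneg_right (A.le_opNorm x) (norm_nonneg _))
    have h2 : ‖A‖ ≤ 1 := hAn.trans hq.le
    nlinarith [mul_le_mul_of_nonneg_right h2 (sq_nonneg ‖x‖)]
  · change (√m • (1 - A)) * (√m • (1 - A)) = T
    rw [smul_mul_smul_comm, Real.mul_self_sqrt hm0.le, hAB, hB, sub_sub_cancel, smul_smul,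
      mul_inv_cancel₀ hm0.ne', one_smul]

theorem StronglyPositive.opSqrt_spec (hT : StronglyPositive T) :
    (opSqrt T).IsPositive ∧ opSqrt T ∘L opSqrt T = T :=
  Classical.epsilon_spec hT.exists_sqrt

theorem StronglyPositive.isInvertible (hT : StronglyPositive T) : T.IsInvertible := by
  obtain ⟨-, c, hc, hTc⟩ := hT
  have h : IsUnit T := ContinuousLinearMap.isUnit_of_forall_le_norm_inner_map T (c := ⟨c, hc.le⟩)
    hc fun x => by
      rw [mul_comm]
      exact (hTc x).trans (Real.le_norm_self _)
  obtain ⟨u, hu⟩ := h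
  exact ⟨ContinuousLinearEquiv.unitsEquiv ℝ E u, hu⟩

theorem StronglyPositive.map_inverse (hT : StronglyPositive T) (x : E) : T (T.inverse x) = x :=
  ((hT.isInvertible.inverse_apply_eq).1 rfl).symm

theorem StronglyPositive.inverse_map (hT : StronglyPositive T) (x : E) : T.inverse (T x) = x :=
  (hT.isInvertible.inverse_apply_eq).2 rfl

theorem StronglyPositive.inverse_inner_map_comm (hT : StronglyPositive T) (x y : E) :
    inner ℝ (T.inverse x) y = inner ℝ x (T.inverse y) := by
  conv_lhs => rw [← hT.map_inverse y, ← hT.inner_map_comm, hT.map_inverse]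

theorem StronglyPositive.exists_inverse_coercive (hT : StronglyPositive T) :
    ∃ c : ℝ, 0 < c ∧ ∀ x, c * ‖x‖ ^ 2 ≤ inner ℝ (T.inverse x) x := by
  obtain ⟨c, hc, hTc⟩ := hT.2
  refine ⟨c / (‖T‖ ^ 2 + 1), by positivity, fun x => ?_⟩
  have h1 := hTc (T.inverse x)
  rw [hT.map_inverse, real_inner_comm] at h1
  have h2 : ‖x‖ ^ 2 ≤ ‖T‖ ^ 2 * ‖T.inverse x‖ ^ 2 := by
    rw [← mul_pow]
    refine pow_le_pow_left₀ (norm_nonneg _) ?_ 2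
    simpa only [hT.map_inverse] using T.le_opNorm (T.inverse x)
  refine le_trans ?_ h1
  rw [div_mul_eq_mul_div, div_le_iff₀ (by positivity), mul_assoc]
  refine mul_le_mul_of_nonneg_left ?_ hc.le
  nlinarith [sq_nonneg ‖T.inverse x‖]

/-- The vector `T^{1/2} T⁻¹ x` maps to `x` under `T^{1/2}` and has squared norm `⟪T⁻¹ x, x⟫`. -/
theorem StronglyPositive.exists_sqrt_preimage (hT : StronglyPositive T) (x : E) :
    ∃ y, opSqrt T y = x ∧ ‖y‖ ^ 2 = inner ℝ (T.inverse x) x := by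
  obtain ⟨hpos, hsq⟩ := hT.opSqrt_spec
  have hsq' : ∀ z, opSqrt T (opSqrt T z) = T z := fun z => DFunLike.congr_fun hsq z
  refine ⟨opSqrt T (T.inverse x), by rw [hsq', hT.map_inverse], ?_⟩
  rw [← real_inner_self_eq_norm_sq, hpos.inner_left_eq_inner_right, hsq', hT.map_inverse]

theorem StronglyPositive.norm_opSqrt_sq (hT : StronglyPositive T) : ‖opSqrt T‖ ^ 2 = ‖T‖ := by
  obtain ⟨hpos, hsq⟩ := hT.opSqrt_spec
  have h := ContinuousLinearMap.norm_adjoint_comp_self (opSqrt T)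
  have h' : (opSqrt T).adjoint = opSqrt T := hpos.isSelfAdjoint
  rw [h', hsq] at h
  rw [h, sq]

/-- The sharp constant matters here: it is the factor ‖V‖⁻¹ in γ. It comes from ‖T^{1/2}‖² = ‖T‖
applied to x = T^{1/2} y. -/
theorem StronglyPositive.norm_sq_le_inverse (hT : StronglyPositive T) (x : E) :
    ‖T‖⁻¹ * ‖x‖ ^ 2 ≤ inner ℝ (T.inverse x) x := by
  obtain ⟨y, hy, hyn⟩ := hT.exists_sqrt_preimage x
  have h1 : ‖x‖ ^ 2 ≤ ‖T‖ * ‖y‖ ^ 2 := by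
    rw [← hT.norm_opSqrt_sq, ← mul_pow, ← hy]
    exact pow_le_pow_left₀ (norm_nonneg _) ((opSqrt T).le_opNorm y) 2
  rw [← hyn]
  rcases (norm_nonneg T).eq_or_lt with h0 | h0
  · rw [← h0, inv_zero, zero_mul]; exact sq_nonneg _
  · rwa [inv_mul_eq_div, div_le_iff₀ h0, mul_comm]

/-- Writing x = T^{1/2} x₁ and y = W^{1/2} y₁ turns the pairing into ⟪W^{1/2} D T^{1/2} x₁, y₁⟫,
which is the source of the operator norms in γ. -/
theorem abs_inner_map_le_sqrt {F : Type*} [NormedAddCommGroup F] [InnerProductSpace ℝ F]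
    [CompleteSpace F] {W : F →L[ℝ] F} (hT : StronglyPositive T) (hW : StronglyPositive W)
    (D : E →L[ℝ] F) (x : E) (y : F) :
    inner ℝ (D x) y ≤ ‖opSqrt W ∘L D ∘L opSqrt T‖ *
      (√(inner ℝ (T.inverse x) x) * √(inner ℝ (W.inverse y) y)) := by
  obtain ⟨x₁, hx, hxn⟩ := hT.exists_sqrt_preimage x
  obtain ⟨y₁, hy, hyn⟩ := hW.exists_sqrt_preimage y
  rw [← hxn, ← hyn, Real.sqrt_sq (norm_nonneg _), Real.sqrt_sq (norm_nonneg _), ← hx, ← hy,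
    ← hW.opSqrt_spec.1.inner_left_eq_inner_right]
  refine (real_inner_le_norm _ _).trans ?_
  rw [← mul_assoc]
  exact mul_le_mul_of_nonneg_right ((opSqrt W ∘L D ∘L opSqrt T).le_opNorm x₁) (norm_nonneg _)

/-- Coercivity of the primal-dual preconditioner. -/
theorem preconditioner_coercive {s : ℕ} {G : Fin s → Type*} [∀ k, NormedAddCommGroup (G k)]
    [∀ k, InnerProductSpace ℝ (G k)] [∀ k, CompleteSpace (G k)] (hT : StronglyPositive T)
    {W : (k : Fin s) → G k →L[ℝ] G k} (hW : ∀ k, StronglyPositive (W k))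
    (D : (k : Fin s) → E →L[ℝ] G k) (w : E) (v : (k : Fin s) → G k) :
    (1 - √(∑ k, ‖opSqrt (W k) ∘L D k ∘L opSqrt T‖ ^ 2)) *
        (inner ℝ (T.inverse w) w + ∑ k, inner ℝ ((W k).inverse (v k)) (v k)) ≤
      inner ℝ (T.inverse w) w + ∑ k, inner ℝ ((W k).inverse (v k)) (v k) -
        2 * ∑ k, inner ℝ (D k w) (v k) := by
  have pos : ∀ {F : Type _} [NormedAddCommGroup F] [InnerProductSpace ℝ F] [CompleteSpace F]
      {M : F →L[ℝ] F}, StronglyPositive M → ∀ x, 0 ≤ inner ℝ (M.inverse x) x := by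
    intro F _ _ _ M hM x
    obtain ⟨y, -, hy⟩ := hM.exists_sqrt_preimage x
    rw [← hy]; exact sq_nonneg _
  set δ := √(∑ k, ‖opSqrt (W k) ∘L D k ∘L opSqrt T‖ ^ 2) with hδ
  set a := √(inner ℝ (T.inverse w) w) with ha
  set b := √(∑ k, inner ℝ ((W k).inverse (v k)) (v k)) with hb
  have hposT : 0 ≤ inner ℝ (T.inverse w) w := by
    obtain ⟨y, -, hy⟩ := hT.exists_sqrt_preimage w
    rw [← hy]; exact sq_nonneg _
  have hposW : ∀ k, 0 ≤ inner ℝ ((W k).inverse (v k)) (v k) := fun k => pos (hW k) (v k)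
  have ha2 : inner ℝ (T.inverse w) w = a ^ 2 := (Real.sq_sqrt hposT).symm
  have hb2 : ∑ k, inner ℝ ((W k).inverse (v k)) (v k) = b ^ 2 :=
    (Real.sq_sqrt (Finset.sum_nonneg fun k _ => hposW k)).symm
  have h1 : ∑ k, inner ℝ (D k w) (v k) ≤ a * (δ * b) := by
    calc ∑ k, inner ℝ (D k w) (v k)
        ≤ ∑ k, a * (‖opSqrt (W k) ∘L D k ∘L opSqrt T‖ *
            √(inner ℝ ((W k).inverse (v k)) (v k))) := by
          refine Finset.sum_le_sum fun k _ => (abs_inner_map_le_sqrt hT (hW k) (D k) w (v k)).trans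
            (le_of_eq ?_)
          ring
      _ = a * ∑ k, ‖opSqrt (W k) ∘L D k ∘L opSqrt T‖ *
            √(inner ℝ ((W k).inverse (v k)) (v k)) := (Finset.mul_sum _ _ _).symm
      _ ≤ a * (δ * b) := by
          refine mul_le_mul_of_nonneg_left ?_ (Real.sqrt_nonneg _)
          refine (Real.sum_mul_le_sqrt_mul_sqrt _ _ _).trans (le_of_eq ?_)
          simp only [Real.sq_sqrt (hposW _), hδ, hb]
  rw [ha2, hb2]
  have hδ0 : 0 ≤ δ := Real.sqrt_nonneg _
  -- What remains is 2ab ≤ a² + b², multiplied by δ.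
  nlinarith [mul_nonneg hδ0 (sq_nonneg (a - b))]

end Operators

/-! ### The product space, the preconditioner and the saddle relation. -/

section PrimalDualSpace

variable {H : Type*} [NormedAddCommGroup H] [InnerProductSpace ℝ H]
  {s : ℕ} {G : Fin s → Type*} [∀ k, NormedAddCommGroup (G k)] [∀ k, InnerProductSpace ℝ (G k)]

/-- This form has a real number on the right, as `le_of_weakTendsto` requires for limits of
subgradient inequalities. -/
theorem IsClosedConvex.mem_subdifferential_iff {E : Type*} [NormedAddCommGroup E]
    [InnerProductSpace ℝ E] {h : E → EReal} (hh : IsClosedConvex h) {x p : E} :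
    p ∈ subdifferential h x ↔
      ∀ (y : E) (c : ℝ), h y ≤ c → h x ≤ ((c - inner ℝ (y - x) p : ℝ) : EReal) := by
  constructor
  · intro hp y c hc
    have h1 := (hp y).trans hc
    have hx : h x ≠ ⊤ := by
      intro htop
      rw [htop, EReal.top_add_coe, top_le_iff] at h1
      exact EReal.coe_ne_top _ h1
    lift h x to ℝ using ⟨hx, hh.ne_bot x⟩ with a
    norm_cast at h1 ⊢
    linarith
  · intro H y
    by_cases hy : h y = ⊤
    · rw [hy]; exact le_top
    · have h1 := H y (h y).toReal (EReal.le_coe_toReal hy)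
      rw [← EReal.coe_toReal hy (hh.ne_bot y)]
      have hx : h x ≠ ⊤ := ne_top_of_le_ne_top (EReal.coe_ne_top _) h1
      lift h x to ℝ using ⟨hx, hh.ne_bot x⟩ with a
      norm_cast at h1 ⊢
      linarith

/-- The Hilbert direct sum of the primal space and the dual spaces. -/
abbrev PrimalDualSpace (H : Type*) {s : ℕ} (G : Fin s → Type*) : Type _ :=
  WithLp 2 (H × PiLp 2 G)

namespace PrimalDualSpace

/-- The pair `(w, v)` as an element of the Hilbert direct sum. -/
def mk (w : H) (v : (k : Fin s) → G k) : PrimalDualSpace H G := WithLp.toLp 2 (w, WithLp.toLp 2 v)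

/-- The primal component. -/
noncomputable def primal (H : Type*) [NormedAddCommGroup H] [InnerProductSpace ℝ H]
    {s : ℕ} (G : Fin s → Type*) [∀ k, NormedAddCommGroup (G k)] [∀ k, InnerProductSpace ℝ (G k)] :
    PrimalDualSpace H G →L[ℝ] H :=
  WithLp.fstL 2 ℝ H (PiLp 2 G)

/-- The dual components. -/
noncomputable def dual (H : Type*) [NormedAddCommGroup H] [InnerProductSpace ℝ H]
    {s : ℕ} (G : Fin s → Type*) [∀ k, NormedAddCommGroup (G k)] [∀ k, InnerProductSpace ℝ (G k)]
    (k : Fin s) : PrimalDualSpace H G →L[ℝ] G k :=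
  PiLp.proj 2 G k ∘L WithLp.sndL 2 ℝ H (PiLp 2 G)

@[simp] theorem primal_mk (w : H) (v : (k : Fin s) → G k) : primal H G (mk w v) = w := rfl

@[simp] theorem dual_mk (w : H) (v : (k : Fin s) → G k) (k : Fin s) :
    dual H G k (mk w v) = v k := rfl

theorem inner_eq (x y : PrimalDualSpace H G) :
    inner ℝ x y = inner ℝ (primal H G x) (primal H G y) +
      ∑ k, inner ℝ (dual H G k x) (dual H G k y) := rfl

variable [CompleteSpace H] [∀ k, CompleteSpace (G k)]

theorem adjoint_primal (b : H) : (primal H G).adjoint b = mk b fun _ => 0 := by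
  refine ext_inner_right ℝ fun y => ?_
  rw [ContinuousLinearMap.adjoint_inner_left, inner_eq]
  simp

/-- Presents the pairing as a sum of bounded operators, so measurability, integrability and norm
bounds follow componentwise. -/
theorem mk_eq_sum (w : H) (v : (k : Fin s) → G k) :
    mk w v = (primal H G).adjoint w + ∑ k, (dual H G k).adjoint (v k) := by
  refine ext_inner_right ℝ fun y => ?_
  rw [inner_add_left, sum_inner, inner_eq]
  simp [ContinuousLinearMap.adjoint_inner_left]

end PrimalDualSpace

open PrimalDualSpace

variable [CompleteSpace H] [∀ k, CompleteSpace (G k)]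
  {f : H → ℝ} {g : (k : Fin s) → G k → ENNReal} {D : (k : Fin s) → H →L[ℝ] G k}
  {V : H →L[ℝ] H} {W : (k : Fin s) → G k →L[ℝ] G k}

/-- The preconditioner `(w, v) ↦ (V⁻¹ w - ∑ₖ Dₖ* vₖ, Wₖ⁻¹ vₖ - Dₖ w)`. -/
noncomputable def preconditioner (D : (k : Fin s) → H →L[ℝ] G k) (V : H →L[ℝ] H)
    (W : (k : Fin s) → G k →L[ℝ] G k) : PrimalDualSpace H G →L[ℝ] PrimalDualSpace H G :=
  (WithLp.prodContinuousLinearEquiv 2 ℝ H (PiLp 2 G)).symm.toContinuousLinearMap ∘L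
    ((V.inverse ∘L primal H G - ∑ k, (D k).adjoint ∘L dual H G k).prod
      ((PiLp.continuousLinearEquiv 2 ℝ G).symm.toContinuousLinearMap ∘L
        ContinuousLinearMap.pi fun k => (W k).inverse ∘L dual H G k - D k ∘L primal H G))

theorem primal_preconditioner (x : PrimalDualSpace H G) :
    primal H G (preconditioner D V W x) =
      V.inverse (primal H G x) - ∑ k, (D k).adjoint (dual H G k x) := by
  change (V.inverse ∘L primal H G - ∑ k, (D k).adjoint ∘L dual H G k) x = _
  simp

theorem dual_preconditioner (x : PrimalDualSpace H G) (k : Fin s) :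
    dual H G k (preconditioner D V W x) =
      (W k).inverse (dual H G k x) - D k (primal H G x) := rfl

/-- The monotone relation `(∂f(w) + ∑ₖ Dₖ* vₖ) × ∏ₖ (∂gₖ*(vₖ) - Dₖ w)`. -/
def saddleRelation (f : H → ℝ) (g : (k : Fin s) → G k → ENNReal) (D : (k : Fin s) → H →L[ℝ] G k)
    (x : PrimalDualSpace H G) : Set (PrimalDualSpace H G) :=
  {p | primal H G p - ∑ k, (D k).adjoint (dual H G k x) ∈
      subdifferential (fun w => (f w : EReal)) (primal H G x) ∧
    ∀ k, dual H G k p + D k (primal H G x) ∈ subdifferential (conjugate (g k)) (dual H G k x)}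

theorem isPrimalDualSolution_iff {F : H → ℝ} {w : H} {v : (k : Fin s) → G k} :
    IsPrimalDualSolution F f g D w v ↔
      -((primal H G).adjoint (gradient F w)) ∈ saddleRelation f g D (mk w v) := by
  have hdual : ∀ k, dual H G k (-((primal H G).adjoint (gradient F w))) = 0 := fun k => by
    rw [adjoint_primal, map_neg, dual_mk, neg_zero]
  have hprimal : primal H G (-((primal H G).adjoint (gradient F w))) = -gradient F w := by
    rw [adjoint_primal, map_neg, primal_mk]
  simp only [saddleRelation, Set.mem_ofPred_eq, hdual, hprimal, primal_mk, dual_mk, zero_add]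
  refine and_congr ⟨?_, fun h => ⟨_, h, by abel⟩⟩ (forall_congr' fun k =>
    ⟨?_, fun h => ⟨_, h, by abel⟩⟩)
  · rintro ⟨p, hp, h0⟩
    have : -gradient F w - ∑ k, (D k).adjoint (v k) = p := by
      have h1 : p = (gradient F w + p + ∑ k, (D k).adjoint (v k)) - gradient F w -
        ∑ k, (D k).adjoint (v k) := by abel
      rw [h1, ← h0]; abel
    rwa [this]
  · rintro ⟨q, hq, h0⟩
    rwa [neg_add_eq_zero.1 h0.symm]

theorem preconditioner_symm (hV : StronglyPositive V) (hW : ∀ k, StronglyPositive (W k))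
    (x y : PrimalDualSpace H G) :
    inner ℝ (preconditioner D V W x) y = inner ℝ x (preconditioner D V W y) := by
  rw [inner_eq, inner_eq]
  simp only [primal_preconditioner, dual_preconditioner, inner_sub_left, inner_sub_right,
    sum_inner, inner_sum, ContinuousLinearMap.adjoint_inner_left,
    ContinuousLinearMap.adjoint_inner_right, Finset.sum_sub_distrib,
    hV.inverse_inner_map_comm, (hW _).inverse_inner_map_comm]
  ring

theorem inner_preconditioner_self (x : PrimalDualSpace H G) :
    inner ℝ (preconditioner D V W x) x =
      inner ℝ (V.inverse (primal H G x)) (primal H G x) +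
        ∑ k, inner ℝ ((W k).inverse (dual H G k x)) (dual H G k x) -
        2 * ∑ k, inner ℝ (D k (primal H G x)) (dual H G k x) := by
  rw [inner_eq]
  simp only [primal_preconditioner, dual_preconditioner, inner_sub_left,
    sum_inner, ContinuousLinearMap.adjoint_inner_left, Finset.sum_sub_distrib]
  have h : ∑ k, inner ℝ (dual H G k x) (D k (primal H G x)) =
      ∑ k, inner ℝ (D k (primal H G x)) (dual H G k x) :=
    Finset.sum_congr rfl fun k _ => real_inner_comm _ _
  rw [h]; ring

theorem exists_preconditioner_coercive (hV : StronglyPositive V) (hW : ∀ k, StronglyPositive (W k))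
    (hδ : √(∑ k, ‖opSqrt (W k) ∘L D k ∘L opSqrt V‖ ^ 2) < 1) :
    ∃ c : ℝ, 0 < c ∧ ∀ x : PrimalDualSpace H G,
      c * ‖x‖ ^ 2 ≤ inner ℝ (preconditioner D V W x) x := by
  obtain ⟨c, hc, hVc⟩ := hV.exists_inverse_coercive
  choose d hd hWd using fun k => (hW k).exists_inverse_coercive
  obtain ⟨m, hm, hmc, hmd⟩ : ∃ m : ℝ, 0 < m ∧ m ≤ c ∧ ∀ k, m ≤ d k := by
    rcases isEmpty_or_nonempty (Fin s) with h | h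
    · exact ⟨c, hc, le_rfl, fun k => h.elim k⟩
    · obtain ⟨k, hk⟩ := Finite.exists_min d
      exact ⟨min c (d k), lt_min hc (hd k), min_le_left _ _, fun j => (min_le_right _ _).trans (hk j)⟩
  refine ⟨(1 - √(∑ k, ‖opSqrt (W k) ∘L D k ∘L opSqrt V‖ ^ 2)) * m,
    mul_pos (by linarith) hm, fun x => ?_⟩
  rw [inner_preconditioner_self]
  refine le_trans ?_ (preconditioner_coercive hV hW D (primal H G x) fun k => dual H G k x)
  rw [mul_assoc]
  refine mul_le_mul_of_nonneg_left ?_ (by linarith)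
  rw [← real_inner_self_eq_norm_sq, inner_eq, mul_add, Finset.mul_sum]
  simp only [real_inner_self_eq_norm_sq]
  refine add_le_add ?_ (Finset.sum_le_sum fun k _ => ?_)
  · exact (mul_le_mul_of_nonneg_right hmc (sq_nonneg _)).trans (hVc _)
  · exact (mul_le_mul_of_nonneg_right (hmd k) (sq_nonneg _)).trans (hWd k _)

theorem norm_primal_sq_le (hV : StronglyPositive V) (hW : ∀ k, StronglyPositive (W k))
    (hδ : √(∑ k, ‖opSqrt (W k) ∘L D k ∘L opSqrt V‖ ^ 2) < 1) (x : PrimalDualSpace H G) :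
    (1 - √(∑ k, ‖opSqrt (W k) ∘L D k ∘L opSqrt V‖ ^ 2)) * ‖V‖⁻¹ * ‖primal H G x‖ ^ 2 ≤
      inner ℝ (preconditioner D V W x) x := by
  rw [inner_preconditioner_self]
  refine le_trans ?_ (preconditioner_coercive hV hW D (primal H G x) fun k => dual H G k x)
  rw [mul_assoc]
  refine mul_le_mul_of_nonneg_left ?_ (by linarith)
  refine (hV.norm_sq_le_inverse _).trans (le_add_of_nonneg_right (Finset.sum_nonneg fun k _ => ?_))
  obtain ⟨d, hd, hWd⟩ := (hW k).exists_inverse_coercive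
  exact le_trans (by positivity) (hWd _)

/-- The coupling is skew: the terms in D_k and its adjoint cancel, leaving the monotonicity of the
subdifferentials. -/
theorem saddleRelation_monotone (hf : IsClosedConvex fun w => (f w : EReal))
    (hg : ∀ k, IsClosedConvex (conjugate (g k))) {x y p q : PrimalDualSpace H G}
    (hp : p ∈ saddleRelation f g D x) (hq : q ∈ saddleRelation f g D y) :
    0 ≤ inner ℝ (p - q) (x - y) := by
  have h1 := inner_sub_nonneg_of_mem_subdifferential hf hp.1 hq.1
  have h2 := fun k => inner_sub_nonneg_of_mem_subdifferential (hg k) (hp.2 k) (hq.2 k)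
  have h3 := add_nonneg h1 (Finset.sum_nonneg fun k (_ : k ∈ Finset.univ) => h2 k)
  have e1 : primal H G p - ∑ k, (D k).adjoint (dual H G k x) -
      (primal H G q - ∑ k, (D k).adjoint (dual H G k y)) =
      primal H G (p - q) - ∑ k, (D k).adjoint (dual H G k (x - y)) := by
    simp only [map_sub, Finset.sum_sub_distrib]; abel
  have e2 : ∀ k, dual H G k p + D k (primal H G x) - (dual H G k q + D k (primal H G y)) =
      dual H G k (p - q) + D k (primal H G (x - y)) := fun k => by
    simp only [map_sub]; abel
  rw [e1] at h3
  simp only [e2, ← map_sub] at h3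
  rw [inner_sub_left, sum_inner] at h3
  simp only [inner_add_left, ContinuousLinearMap.adjoint_inner_left, Finset.sum_add_distrib] at h3
  have h4 : ∑ k, inner ℝ (dual H G k (x - y)) (D k (primal H G (x - y))) =
      ∑ k, inner ℝ (D k (primal H G (x - y))) (dual H G k (x - y)) :=
    Finset.sum_congr rfl fun k _ => real_inner_comm _ _
  rw [h4] at h3
  rw [inner_eq]
  linarith

theorem exists_tendsto_ultrafilter_of_bounded (U : Ultrafilter ℕ) {r : ℕ → ℝ} {C : ℝ}
    (h : ∀ n, |r n| ≤ C) : ∃ r₀, Tendsto r U (𝓝 r₀) := by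
  obtain ⟨r₀, -, h₀⟩ := (isCompact_Icc (a := -C) (b := C)).ultrafilter_le_nhds (U.map r)
    (le_principal_iff.2 (Filter.mem_map.2 (univ_mem' fun n => abs_le.1 (h n))))
  exact ⟨r₀, h₀⟩

/-- The coupling terms ⟪D_k wₙ, v_{k,n}⟫ are not weakly continuous, so only limits τ k along the
ultrafilter are available. They occur with opposite signs in the primal and dual inequalities;
testing these at the limit point itself bounds τ from both sides and identifies it. -/
theorem saddleRelation_closed (hf : IsClosedConvex fun w => (f w : EReal))
    (hg : ∀ k, IsClosedConvex (conjugate (g k))) {U : Ultrafilter ℕ}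
    {x p : ℕ → PrimalDualSpace H G} {x₀ p₀ : PrimalDualSpace H G} {C : ℝ}
    (hx : WeakTendsto x U x₀) (hC : ∀ n, ‖x n‖ ≤ C) (hp : Tendsto p U (𝓝 p₀))
    (hA : ∀ n, p n ∈ saddleRelation f g D (x n)) : p₀ ∈ saddleRelation f g D x₀ := by
  have hxw := hx.map (primal H G)
  have hxv := fun k => hx.map (dual H G k)
  have hpw := ((primal H G).continuous.tendsto p₀).comp hp
  have hpv := fun k => ((dual H G k).continuous.tendsto p₀).comp hp
  have hbw : ∀ n, ‖primal H G (x n)‖ ≤ ‖primal H G‖ * C := fun n =>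
    ((primal H G).le_opNorm _).trans (mul_le_mul_of_nonneg_left (hC n) (norm_nonneg _))
  have hbv : ∀ k n, ‖dual H G k (x n)‖ ≤ ‖dual H G k‖ * C := fun k n =>
    ((dual H G k).le_opNorm _).trans (mul_le_mul_of_nonneg_left (hC n) (norm_nonneg _))
  have hbD : ∀ k n, ‖D k (primal H G (x n))‖ ≤ ‖D k‖ * (‖primal H G‖ * C) := fun k n =>
    ((D k).le_opNorm _).trans (mul_le_mul_of_nonneg_left (hbw n) (norm_nonneg _))
  choose τ hτ using fun k => exists_tendsto_ultrafilter_of_bounded U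
    (r := fun n => inner ℝ (D k (primal H G (x n))) (dual H G k (x n)))
    (C := ‖D k‖ * (‖primal H G‖ * C) * (‖dual H G k‖ * C)) fun n =>
      (abs_real_inner_le_norm _ _).trans
        (mul_le_mul (hbD k n) (hbv k n) (norm_nonneg _) ((norm_nonneg _).trans (hbD k n)))
  -- the limits of the two families of subgradient inequalities
  have limf : ∀ y, f (primal H G x₀) ≤ f y - (inner ℝ (primal H G p₀) (y - primal H G x₀) -
      ∑ k, inner ℝ (D k y) (dual H G k x₀) + ∑ k, τ k) := by
    intro y
    refine EReal.coe_le_coe_iff.1 (hf.le_of_weakTendsto U _ _ (fun n => f y -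
      (inner ℝ (primal H G (p n)) (y - primal H G (x n)) -
        ∑ k, inner ℝ (D k y) (dual H G k (x n)) +
        ∑ k, inner ℝ (D k (primal H G (x n))) (dual H G k (x n)))) _ hxw ?_ fun n => ?_)
    · refine tendsto_const_nhds.sub (Tendsto.add (Tendsto.sub ?_ ?_) ?_)
      · simp only [inner_sub_right]
        exact (hpw.inner tendsto_const_nhds).sub (hxw.inner_of_tendsto hpw hbw)
      · exact tendsto_finsetSum _ fun k _ => hxv k (D k y)
      · exact tendsto_finsetSum _ fun k _ => hτ k
    · refine (hf.mem_subdifferential_iff.1 (hA n).1 y (f y) le_rfl).trans (le_of_eq ?_)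
      congr 2
      rw [real_inner_comm, inner_sub_left, sum_inner]
      simp only [ContinuousLinearMap.adjoint_inner_left, inner_sub_right (𝕜 := ℝ),
        Finset.sum_sub_distrib]
      have e : ∀ z : H, ∑ k, inner ℝ (dual H G k (x n)) (D k z) =
          ∑ k, inner ℝ (D k z) (dual H G k (x n)) := fun z =>
        Finset.sum_congr rfl fun k _ => real_inner_comm _ _
      rw [e, e]; ring
  have limg : ∀ k q c, conjugate (g k) q ≤ (c : ℝ) → conjugate (g k) (dual H G k x₀) ≤
      ((c - (inner ℝ (dual H G k p₀) (q - dual H G k x₀) +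
        inner ℝ q (D k (primal H G x₀)) - τ k) : ℝ) : EReal) := by
    intro k q c hc
    refine (hg k).le_of_weakTendsto U _ _ (fun n => c -
      (inner ℝ (dual H G k (p n)) (q - dual H G k (x n)) +
        inner ℝ q (D k (primal H G (x n))) -
        inner ℝ (D k (primal H G (x n))) (dual H G k (x n)))) _ (hxv k) ?_ fun n => ?_
    · refine tendsto_const_nhds.sub (Tendsto.sub (Tendsto.add ?_ ?_) (hτ k))
      · simp only [inner_sub_right]
        exact ((hpv k).inner tendsto_const_nhds).sub ((hxv k).inner_of_tendsto (hpv k) (hbv k))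
      · exact hxw.map (D k) q
    · refine ((hg k).mem_subdifferential_iff.1 ((hA n).2 k) q c hc).trans (le_of_eq ?_)
      congr 2
      rw [real_inner_comm, inner_add_left, inner_sub_right (D k (primal H G (x n))),
        real_inner_comm q]
      ring
  -- the limits of the coupling terms
  have hτle : ∑ k, τ k ≤ ∑ k, inner ℝ (D k (primal H G x₀)) (dual H G k x₀) := by
    have := limf (primal H G x₀)
    rw [sub_self, inner_zero_right] at this
    linarith
  have hτge : ∀ k, inner ℝ (D k (primal H G x₀)) (dual H G k x₀) ≤ τ k := by
    intro k
    obtain ⟨q, hq⟩ := (hg k).exists_ne_top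
    have hfin : conjugate (g k) (dual H G k x₀) ≠ ⊤ :=
      ne_top_of_le_ne_top (EReal.coe_ne_top _) (limg k q _ (EReal.le_coe_toReal hq))
    have h1 := limg k (dual H G k x₀) _ (EReal.le_coe_toReal hfin)
    rw [← EReal.coe_toReal hfin ((hg k).ne_bot _), EReal.coe_le_coe_iff, EReal.toReal_coe,
      sub_self, inner_zero_right, real_inner_comm] at h1
    linarith
  -- The primal inequality bounds only the sum of the τ k from above; the termwise lower bounds then
  -- force equality for each k.
  have hτeq : ∀ k, τ k = inner ℝ (D k (primal H G x₀)) (dual H G k x₀) := by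
    have h1 := (Finset.sum_eq_sum_iff_of_le fun k (_ : k ∈ Finset.univ) => hτge k).1
      (le_antisymm (Finset.sum_le_sum fun k _ => hτge k) hτle)
    exact fun k => (h1 k (Finset.mem_univ k)).symm
  constructor
  · rw [hf.mem_subdifferential_iff]
    intro y c hc
    rw [EReal.coe_le_coe_iff] at hc ⊢
    have h1 := limf y
    simp only [hτeq] at h1
    rw [real_inner_comm, inner_sub_left, sum_inner]
    have h2 : ∑ k, inner ℝ ((D k).adjoint (dual H G k x₀)) (y - primal H G x₀) =
        ∑ k, inner ℝ (D k y) (dual H G k x₀) -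
          ∑ k, inner ℝ (D k (primal H G x₀)) (dual H G k x₀) := by
      rw [← Finset.sum_sub_distrib]
      refine Finset.sum_congr rfl fun k _ => ?_
      rw [ContinuousLinearMap.adjoint_inner_left, map_sub, inner_sub_right, real_inner_comm,
        real_inner_comm (D k (primal H G x₀))]
    rw [h2]
    linarith
  · intro k
    rw [(hg k).mem_subdifferential_iff]
    intro q c hc
    refine (limg k q c hc).trans (le_of_eq ?_)
    congr 2
    rw [hτeq, real_inner_comm (dual H G k p₀ + D k (primal H G x₀)), inner_add_left,
      inner_sub_right (D k (primal H G x₀)), real_inner_comm q]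
    ring

/-- The off-diagonal part of the preconditioner cancels the adjoint coupling in the primal row and
doubles the coupling in the dual rows. The system is block triangular: solve for `w`, then for each
`v k` with 2 D_k w. -/
theorem exists_saddleRelation_resolvent (hf : IsClosedConvex fun w => (f w : EReal))
    (hg : ∀ k, IsClosedConvex (conjugate (g k))) (hV : StronglyPositive V)
    (hW : ∀ k, StronglyPositive (W k)) (y : PrimalDualSpace H G) :
    ∃ x, y - preconditioner D V W x ∈ saddleRelation f g D x := by
  obtain ⟨c, hc, hVc⟩ := hV.exists_inverse_coercive
  obtain ⟨w, hw⟩ := exists_isProx hV.inverse_inner_map_comm hc hVc hf (V (primal H G y))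
  have hdual : ∀ k, ∃ v, IsProx (W k).inverse (conjugate (g k))
      (W k (dual H G k y + (2 : ℝ) • D k w)) v := fun k => by
    obtain ⟨d, hd, hWd⟩ := (hW k).exists_inverse_coercive
    exact exists_isProx (hW k).inverse_inner_map_comm hd hWd (hg k) _
  choose v hv using hdual
  refine ⟨mk w v, ?_, fun k => ?_⟩
  · have h1 := hw.mem_subdifferential hV.inverse_inner_map_comm hf
    rw [map_sub, hV.inverse_map] at h1
    rw [map_sub, primal_preconditioner]
    simp only [primal_mk, dual_mk]
    rwa [sub_sub, sub_add_cancel]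
  · have h1 := (hv k).mem_subdifferential (hW k).inverse_inner_map_comm (hg k)
    rw [map_sub, (hW k).inverse_map] at h1
    rw [map_sub, dual_preconditioner]
    simp only [primal_mk, dual_mk]
    have e : dual H G k y - ((W k).inverse (v k) - D k w) + D k w =
        dual H G k y + (2 : ℝ) • D k w - (W k).inverse (v k) := by rw [two_smul]; abel
    rwa [e]

/-- The primal-dual iteration is a resolvent step in the preconditioned product space. -/
theorem saddleRelation_of_iteration {α : ℕ → ℝ} {a w : ℕ → H}
    {v : (k : Fin s) → ℕ → G k} (h : IsPrimalDualIteration f g D V W α a w v)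
    (hf : IsClosedConvex fun w => (f w : EReal))
    (hg : ∀ k, IsClosedConvex (conjugate (g k))) (hV : StronglyPositive V)
    (hW : ∀ k, StronglyPositive (W k)) (n : ℕ) :
    preconditioner D V W (mk (extrapolate α w n) fun k => extrapolate α (v k) n) -
        (primal H G).adjoint (a n) -
        preconditioner D V W (mk (w (n + 1)) fun k => v k (n + 1)) ∈
      saddleRelation f g D (mk (w (n + 1)) fun k => v k (n + 1)) := by
  refine ⟨?_, fun k => ?_⟩
  · have h1 := (h.primal n).mem_subdifferential hV.inverse_inner_map_comm hf
    rw [map_sub, map_sub, hV.inverse_map] at h1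
    rw [map_sub, map_sub, primal_preconditioner, primal_preconditioner, adjoint_primal]
    simp only [primal_mk, dual_mk]
    convert h1 using 1
    abel
  · have h1 := (h.dual k n).mem_subdifferential (hW k).inverse_inner_map_comm (hg k)
    rw [map_sub, map_add, (hW k).inverse_map] at h1
    rw [map_sub, map_sub, dual_preconditioner, dual_preconditioner, adjoint_primal]
    simp only [primal_mk, dual_mk]
    convert h1 using 1
    rw [map_sub, two_smul ℝ, map_add]
    abel

end PrimalDualSpace

/-! ### Moduli of convexity and measurability with respect to histories. -/

theorem tendsto_zero_of_modulus {φ : ℝ → ℝ} (hmono : MonotoneOn φ (Set.Ici 0))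
    (hpos : ∀ r : ℝ, 0 < r → 0 < φ r) {r d : ℕ → ℝ} (hr : ∀ n, 0 ≤ r n)
    (hle : ∀ n, φ (r n) ≤ d n) (hd : Tendsto d atTop (𝓝 0)) : Tendsto r atTop (𝓝 0) := by
  rw [Metric.tendsto_nhds]
  intro δ hδ
  filter_upwards [hd.eventually (gt_mem_nhds (hpos δ hδ))] with n hn
  rw [Real.dist_eq, sub_zero, abs_of_nonneg (hr n)]
  by_contra! h
  exact absurd ((hmono (Set.mem_Ici.2 hδ.le) (Set.mem_Ici.2 (hr n)) h).trans (hle n)) hn.not_ge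

/-- Separability of the range does not depend on the σ-algebra, so passing to a smaller one only
requires Borel measurability. -/
theorem stronglyMeasurable_comap {Ω E : Type*} {m m0 : MeasurableSpace Ω} [NormedAddCommGroup E]
    {x : Ω → E} (hx : StronglyMeasurable[m0] x) (hm : MeasurableSpace.comap x (borel E) ≤ m) :
    StronglyMeasurable[m] x := by
  let : MeasurableSpace E := borel E
  have : BorelSpace E := ⟨rfl⟩
  exact stronglyMeasurable_iff_measurable_separable.2
    ⟨measurable_iff_comap_le.2 hm, hx.isSeparable_range⟩

theorem comap_borel_le {Ω E : Type*} {m0 : MeasurableSpace Ω} [NormedAddCommGroup E]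
    {x : Ω → E} (hx : StronglyMeasurable[m0] x) : MeasurableSpace.comap x (borel E) ≤ m0 := by
  let : MeasurableSpace E := borel E
  have : BorelSpace E := ⟨rfl⟩
  exact measurable_iff_comap_le.1 hx.measurable

section History

variable {H : Type*} [NormedAddCommGroup H] [InnerProductSpace ℝ H] [CompleteSpace H]
  {s : ℕ} {G : Fin s → Type*} [∀ k, NormedAddCommGroup (G k)]
  [∀ k, InnerProductSpace ℝ (G k)] [∀ k, CompleteSpace (G k)]
  {Ω : Type*} {m0 : MeasurableSpace Ω} {w : ℕ → Ω → H} {v : (k : Fin s) → ℕ → Ω → G k}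

/-- The histories of a strongly measurable process form a filtration. -/
def historyFiltration (hw : ∀ n, StronglyMeasurable (w n))
    (hv : ∀ k n, StronglyMeasurable (v k n)) : Filtration ℕ m0 where
  seq := history w v
  mono' _ _ hmn := biSup_mono fun _ hi => Set.mem_Iic.2 ((Set.mem_Iic.1 hi).trans hmn)
  le' _ := iSup₂_le fun i _ => sup_le (comap_borel_le (hw i))
    (iSup_le fun k => comap_borel_le (hv k i))

open PrimalDualSpace

theorem stronglyMeasurable_mk {m : MeasurableSpace Ω} {w : Ω → H} {v : (k : Fin s) → Ω → G k}
    (hw : StronglyMeasurable w) (hv : ∀ k, StronglyMeasurable (v k)) :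
    StronglyMeasurable fun ω => mk (w ω) fun k => v k ω := by
  simp only [mk_eq_sum]
  exact ((primal H G).adjoint.continuous.comp_stronglyMeasurable hw).add
    (Finset.stronglyMeasurable_fun_sum _ fun k _ =>
      (dual H G k).adjoint.continuous.comp_stronglyMeasurable (hv k))

theorem memLp_mk {P : Measure Ω} {w : Ω → H} {v : (k : Fin s) → Ω → G k}
    (hw : MemLp w 2 P) (hv : ∀ k, MemLp (v k) 2 P) :
    MemLp (fun ω => mk (w ω) fun k => v k ω) 2 P := by
  simp only [mk_eq_sum]
  exact ((primal H G).adjoint.comp_memLp' hw).add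
    (memLp_finsetSum _ fun k _ => (dual H G k).adjoint.comp_memLp' (hv k))

theorem stronglyMeasurable_mk_history (hw : ∀ n, StronglyMeasurable (w n))
    (hv : ∀ k n, StronglyMeasurable (v k n)) (n : ℕ) :
    StronglyMeasurable[historyFiltration hw hv n] fun ω => mk (w n ω) fun k => v k n ω := by
  have hle : MeasurableSpace.comap (w n) (borel H) ⊔
      ⨆ k, MeasurableSpace.comap (v k n) (borel (G k)) ≤ history w v n :=
    le_biSup (fun i => MeasurableSpace.comap (w i) (borel H) ⊔
      ⨆ k, MeasurableSpace.comap (v k i) (borel (G k))) (Set.mem_Iic.2 le_rfl)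
  exact stronglyMeasurable_mk (stronglyMeasurable_comap (hw n) (le_sup_left.trans hle))
    fun k => stronglyMeasurable_comap (hv k n)
      (((le_iSup (fun k => MeasurableSpace.comap (v k n) (borel (G k))) k).trans
        le_sup_right).trans hle)

end History

end InertialPD

/-! ### The main theorem. -/

theorem theorem2
    {H : Type*} [NormedAddCommGroup H] [InnerProductSpace ℝ H] [CompleteSpace H]
    {s : ℕ} {G : Fin s → Type*} [∀ k, NormedAddCommGroup (G k)]
    [∀ k, InnerProductSpace ℝ (G k)] [∀ k, CompleteSpace (G k)]
    -- the data of the minimization problem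
    {Ξ : Type*} [MeasurableSpace Ξ] (ρ : Measure Ξ) [IsProbabilityMeasure ρ]
    (ℓ : Ξ → H → ℝ) (β : ℝ) (hβ : 0 < β)
    (hℓ_nonneg : ∀ ξ w, 0 ≤ ℓ ξ w)
    (hℓ_int : ∀ w, Integrable (fun ξ => ℓ ξ w) ρ)
    (hℓ_diff : ∀ ξ, Differentiable ℝ (ℓ ξ))
    (hℓ_lip : ∀ ξ w₁ w₂, ‖gradient (ℓ ξ) w₁ - gradient (ℓ ξ) w₂‖ ≤ (1 / β) * ‖w₁ - w₂‖)
    (hF_conv : ConvexOn ℝ Set.univ (expectedLoss ρ ℓ))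
    (f : H → ℝ) (hf_conv : ConvexOn ℝ Set.univ f) (hf_lsc : LowerSemicontinuous f)
    (g : (k : Fin s) → G k → ENNReal)
    (hg_proper : ∀ k, ∃ x, g k x ≠ ⊤)
    (hg_conv : ∀ k, ConvexOn NNReal Set.univ (g k))
    (hg_lsc : ∀ k, LowerSemicontinuous (g k))
    (D : (k : Fin s) → H →L[ℝ] G k)
    (h_sol : ∃ w v, IsPrimalDualSolution (expectedLoss ρ ℓ) f g D w v)
    -- the preconditioners and the parameters
    (V : H →L[ℝ] H) (hV : StronglyPositive V)
    (W : (k : Fin s) → G k →L[ℝ] G k) (hW : ∀ k, StronglyPositive (W k))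
    (ε : ℝ) (hε : ε ∈ Set.Ioo (0 : ℝ) 1)
    (α : ℕ → ℝ) (hα : ∀ n, α n ∈ Set.Icc 0 (1 - ε))
    (γ : ℝ)
    (hγ : γ = (1 - √(∑ k, ‖opSqrt (W k) ∘L D k ∘L opSqrt V‖ ^ 2)) * ‖V‖⁻¹ * β)
    (hγ_half : 1 / 2 < γ) (hεγ : ε < min 1 γ)
    -- the random processes
    {Ω : Type*} [MeasurableSpace Ω] (P : Measure Ω) [IsProbabilityMeasure P]
    (a w : ℕ → Ω → H) (v : (k : Fin s) → ℕ → Ω → G k)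
    (ha_meas : ∀ n, StronglyMeasurable (a n)) (ha_sq : ∀ n, MemLp (a n) 2 P)
    (hw_meas : StronglyMeasurable (w 0)) (hw_sq : MemLp (w 0) 2 P)
    (hv_meas : ∀ k, StronglyMeasurable (v k 0)) (hv_sq : ∀ k, MemLp (v k 0) 2 P)
    (h_iter : ∀ ω, IsPrimalDualIteration f g D V W α
      (fun n => a n ω) (fun n => w n ω) (fun k n => v k n ω))
    -- unbiased gradient estimates with summable conditional variances
    (h_unbiased : ∀ n, P[a n | history w v n] =ᵐ[P]
      fun ω => gradient (expectedLoss ρ ℓ) (extrapolate α (fun i => w i ω) n))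
    (h_var : ∀ᵐ ω ∂P, Summable fun n =>
      (P[fun ω' => ‖a n ω' -
          gradient (expectedLoss ρ ℓ) (extrapolate α (fun i => w i ω') n)‖ ^ 2
        | history w v n]) ω)
    -- bounded increments and summable inertial parameters
    (h_incr_w : ∀ᵐ ω ∂P, BddAbove (Set.range fun n => ‖w n ω - w (n - 1) ω‖))
    (h_incr_v : ∀ᵐ ω ∂P, ∀ k, BddAbove (Set.range fun n => ‖v k n ω - v k (n - 1) ω‖))
    (hα_sum : Summable α) :
    ∃ (wbar : Ω → H) (vbar : (k : Fin s) → Ω → G k),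
      StronglyMeasurable wbar ∧ (∀ k, StronglyMeasurable (vbar k)) ∧
      (∀ᵐ ω ∂P, IsPrimalDualSolution (expectedLoss ρ ℓ) f g D (wbar ω) (fun k => vbar k ω)) ∧
      (∀ᵐ ω ∂P,
        Tendsto (fun n => toWeakSpace ℝ H (w n ω)) atTop (𝓝 (toWeakSpace ℝ H (wbar ω))) ∧
        ∀ k, Tendsto (fun n => toWeakSpace ℝ (G k) (v k n ω)) atTop
          (𝓝 (toWeakSpace ℝ (G k) (vbar k ω)))) ∧
      ((∀ᵐ ω ∂P, UniformlyConvexAt (expectedLoss ρ ℓ) (wbar ω)) →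
        ∀ᵐ ω ∂P, Tendsto (fun n => w n ω) atTop (𝓝 (wbar ω))) := by

  have hquad := expectedLoss_quadratic_bound hβ hℓ_nonneg hℓ_int hℓ_diff hℓ_lip
  set F := expectedLoss ρ ℓ with hF
  have hcoco := cocoercive_of_quadratic_bound hβ hF_conv hquad
  have hf := isClosedConvex_coe hf_conv hf_lsc
  have hg := fun k => isClosedConvex_conjugate (hg_proper k)
  set δ := √(∑ k, ‖opSqrt (W k) ∘L D k ∘L opSqrt V‖ ^ 2) with hδ_def
  have hκβ : 1 / 2 < (1 - δ) * ‖V‖⁻¹ * β := hγ ▸ hγ_half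
  -- Since β and ‖V‖⁻¹ are nonnegative, positivity of the product γ forces κ > 0 and then δ < 1.
  have hκ : 0 < (1 - δ) * ‖V‖⁻¹ :=
    lt_of_mul_lt_mul_right (by rw [zero_mul]; linarith) hβ.le
  have hδ : δ < 1 := by
    have : 0 < 1 - δ :=
      lt_of_mul_lt_mul_right (by rwa [zero_mul]) (inv_nonneg.2 (norm_nonneg V))
    linarith
  choose R hR using exists_saddleRelation_resolvent (D := D) hf hg hV hW
  have hs : IsSplitting (preconditioner D V W) (PrimalDualSpace.primal H G) (saddleRelation f g D)
      (gradient F) R ((1 - δ) * ‖V‖⁻¹) β :=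
    { symm := preconditioner_symm hV hW
      coercive := exists_preconditioner_coercive hV hW hδ
      kappa_pos := hκ
      beta_pos := hβ
      half_lt := hκβ
      norm_sq_le := norm_primal_sq_le hV hW hδ
      cocoercive := hcoco
      monotone := fun _ _ _ _ hp hq => saddleRelation_monotone hf hg hp hq
      mem_of_weakTendsto := fun _ _ _ _ _ _ hx hC hp hA => saddleRelation_closed hf hg hx hC hp hA
      resolvent := hR }
  set x : ℕ → Ω → PrimalDualSpace H G := fun n ω => PrimalDualSpace.mk (w n ω) fun k => v k n ω
    with hx
  have hext : ∀ n ω, extrapolate α (fun i => x i ω) n =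
      PrimalDualSpace.mk (extrapolate α (fun i => w i ω) n)
        fun k => extrapolate α (fun i => v k i ω) n := fun _ _ => rfl
  -- Uniqueness of the resolvent turns the proximal conditions into an explicit recursion through a
  -- Lipschitz map.
  have hstep : ∀ n ω, x (n + 1) ω = R (preconditioner D V W (extrapolate α (fun i => x i ω) n) -
      (PrimalDualSpace.primal H G).adjoint (a n ω)) := fun n ω =>
    hs.eq_resolvent (saddleRelation_of_iteration (h_iter ω) hf hg hV hW n)
  obtain ⟨L, hL⟩ := hs.exists_lipschitz_R
  -- Measurability of later iterates follows from the recursion; strong induction is needed because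
  -- the extrapolation reaches one index further back.
  have hxm : ∀ n, StronglyMeasurable (x n) := by
    intro n
    induction n using Nat.strong_induction_on with
    | _ n ih =>
      cases n with
      | zero => exact stronglyMeasurable_mk hw_meas hv_meas
      | succ n =>
        have h1 : StronglyMeasurable fun ω => extrapolate α (fun i => x i ω) n :=
          (ih n (by omega)).add (((ih n (by omega)).sub (ih (n - 1) (by omega))).const_smul (α n))
        have h2 := hL.continuous.comp_stronglyMeasurable
          (((preconditioner D V W).continuous.comp_stronglyMeasurable h1).sub
            ((PrimalDualSpace.primal H G).adjoint.continuous.comp_stronglyMeasurable (ha_meas n)))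
        exact (funext (hstep n) : x (n + 1) = _) ▸ h2
  have hwm : ∀ n, StronglyMeasurable (w n) := fun n =>
    (PrimalDualSpace.primal H G).continuous.comp_stronglyMeasurable (hxm n)
  have hvm : ∀ k n, StronglyMeasurable (v k n) := fun k n =>
    (PrimalDualSpace.dual H G k).continuous.comp_stronglyMeasurable (hxm n)
  have hit : IsStochasticIteration P (preconditioner D V W) (PrimalDualSpace.primal H G)
      (gradient F) R (historyFiltration hwm hvm) α x a :=
    { adapted := stronglyMeasurable_mk_history hwm hvm
      memLp_zero := memLp_mk hw_sq hv_sq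
      memLp_noise := ha_sq
      step := hstep
      unbiased := h_unbiased
      summable_variance := h_var
      bounded_increments := by
        filter_upwards [h_incr_w, h_incr_v] with ω h1 h2
        obtain ⟨C, hC⟩ := h1
        choose C' hC' using h2
        refine ⟨‖(PrimalDualSpace.primal H G).adjoint‖ * C +
          ∑ k, ‖(PrimalDualSpace.dual H G k).adjoint‖ * C' k, ?_⟩
        rintro _ ⟨n, rfl⟩
        have e : x n ω - x (n - 1) ω = PrimalDualSpace.mk (w n ω - w (n - 1) ω)
            fun k => v k n ω - v k (n - 1) ω := rfl
        simp only [e, PrimalDualSpace.mk_eq_sum]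
        refine (norm_add_le _ _).trans (add_le_add ?_ ((norm_sum_le _ _).trans
          (Finset.sum_le_sum fun k _ => ?_)))
        · exact (ContinuousLinearMap.le_opNorm _ _).trans
            (mul_le_mul_of_nonneg_left (hC ⟨n, rfl⟩) (norm_nonneg _))
        · exact (ContinuousLinearMap.le_opNorm _ _).trans
            (mul_le_mul_of_nonneg_left (hC' k ⟨n, rfl⟩) (norm_nonneg _))
      relaxation_nonneg := fun n => (hα n).1
      relaxation_le_one := fun n => (hα n).2.trans (by linarith [hε.1])
      summable_relaxation := hα_sum }
  obtain ⟨y, hym, hy⟩ := hit.exists_weak_limit hs (by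
    obtain ⟨w', v', h'⟩ := h_sol
    exact ⟨_, isPrimalDualSolution_iff.1 h'⟩)
  refine ⟨fun ω => PrimalDualSpace.primal H G (y ω), fun k ω => PrimalDualSpace.dual H G k (y ω),
    (PrimalDualSpace.primal H G).continuous.comp_stronglyMeasurable hym,
    fun k => (PrimalDualSpace.dual H G k).continuous.comp_stronglyMeasurable hym, ?_, ?_, ?_⟩
  · filter_upwards [hy] with ω hω using isPrimalDualSolution_iff.2 hω.2.1
  · filter_upwards [hy] with ω hω
    exact ⟨weakTendsto_iff_toWeakSpace.1 (hω.1.map (PrimalDualSpace.primal H G)),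
      fun k => weakTendsto_iff_toWeakSpace.1 (hω.1.map (PrimalDualSpace.dual H G k))⟩
  · intro hunif
    filter_upwards [hy, hunif] with ω ⟨_, _, ⟨C, hC⟩, hz, hB⟩ hu
    obtain ⟨φ, hmono, hpos, hφ⟩ := hu.exists_modulus_le_inner
      (gradient_inequality_of_quadratic_bound hF_conv hquad)
    set wbar := PrimalDualSpace.primal H G (y ω)
    set u : ℕ → H := fun n => extrapolate α (fun i => w i ω) n with hu_def
    have hwu : Tendsto (fun n => u n - w n ω) atTop (𝓝 0) := by
      have := ((PrimalDualSpace.primal H G).continuous.tendsto 0).comp hz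
      rwa [map_zero] at this
    have hBu : Tendsto (fun n => ‖gradient F (u n) - gradient F wbar‖) atTop (𝓝 0) :=
      tendsto_iff_norm_sub_tendsto_zero.1 hB
    obtain ⟨C₁, hC₁⟩ := hwu.norm.bddAbove_range
    set C₂ := C₁ + ‖PrimalDualSpace.primal H G‖ * C + ‖wbar‖
    have hbdd : ∀ n, ‖u n - wbar‖ ≤ C₂ := fun n => by
      have h1 : ‖u n - w n ω‖ ≤ C₁ := hC₁ ⟨n, rfl⟩
      have h2 : ‖w n ω‖ ≤ ‖PrimalDualSpace.primal H G‖ * C :=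
        ((PrimalDualSpace.primal H G).le_opNorm (x n ω)).trans
          (mul_le_mul_of_nonneg_left (hC n) (norm_nonneg _))
      have e : u n - wbar = (u n - w n ω) + w n ω - wbar := by abel
      rw [e]
      exact (norm_sub_le _ _).trans (add_le_add_left ((norm_add_le _ _).trans (add_le_add h1 h2)) _)
    -- The modulus at ‖uₙ − w̄‖ is at most ⟪∇F(uₙ) − ∇F(w̄), uₙ − w̄⟫, a null sequence of gradient
    -- differences paired with a bounded one.
    have hlim : Tendsto (fun n => ‖u n - wbar‖) atTop (𝓝 0) := by
      refine tendsto_zero_of_modulus hmono hpos (fun n => norm_nonneg _) (fun n => ?_)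
        (d := fun n => ‖gradient F (u n) - gradient F wbar‖ * C₂) (by simpa using hBu.mul_const C₂)
      exact (hφ (u n)).trans ((real_inner_le_norm _ _).trans
        (mul_le_mul_of_nonneg_left (hbdd n) (norm_nonneg _)))
    have h1 := (tendsto_iff_norm_sub_tendsto_zero.2 hlim).sub hwu
    rw [sub_zero] at h1
    exact h1.congr fun n => sub_sub_cancel _ _
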